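/- Let $p\ge 1$, $1\le j\le p$, $n=(n_1,\dots,n_p)\in\mathbb N_0^p$, and let $\gamma=(\gamma_1,\dots,\gamma_{p+1})\in\mathbb R^{p+1}$ with $\gamma_2,\dots,\gamma_{p+1}\notin\{-1,-2,\dots\}$. Write $N_1^k=n_1+\dots+n_k$, $\gamma_1^k=\gamma_1+\dots+\gamma_k$, $Z_1^k=z_1+\dots+z_k$ for $k\le p$, and $Z_1^{p+1}=1$ (i.e. $z_{p+1}=1-z_1-\dots-z_p$). With $P_m(x;\alpha,\beta)=\frac{(\alpha+1)_m}{m!}\,{}_2F_1\!\left(-m,m+\alpha+\beta+1;\alpha+1;\frac{1-x}2\right)$ (as a polynomial also in $\alpha,\beta$), the multivariable Jacobi polynomials on the simplex are the polynomials in $z=(z_1,\dots,z_p)$ $$J_p(n;z;\gamma)=(-1)^{|n|}\prod_{k=1}^p\frac{n_k!\,(Z_1^{k+1})^{n_k}}{(\gamma_{k+1}+1)_{n_k}}\,P_{n_k}\!\left(1-\frac{2Z_1^k}{Z_1^{k+1}};\,2N_1^{k-1}+\gamma_1^k+k-1,\ \gamma_{k+1}\right).$$ *Operators in $z$.* $$\hat{\mathfrak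 L}^z_j=-2\!\!\sum_{1\le l<m\le\min(j+1,p)}\!\! z_lz_m\partial_{z_l}\partial_{z_m}+\sum_{m=1}^{\min(j+1,p)}\! z_m(Z_1^{j+1}-z_m)\partial_{z_m}^2+\sum_{m=1}^{\min(j+1,p)}\!\big((\gamma_m+1)Z_1^{j+1}-(\gamma_1^{j+1}+j+1)z_m\big)\partial_{z_m}.$$ *Operators in $n$.* For sequences $x_k,\beta_k$ put $B_k^{0,0}=x_k(x_k+\beta_k)+x_{k+1}(x_{k+1}+\beta_{k+1})+\frac12(\beta_k+1)(\beta_{k+1}-1)$, $B_k^{0,1}=(x_{k+1}+x_k+\beta_{k+1})(x_{k+1}-x_k+\beta_{k+1}-\beta_k)$, $B_k^{1,0}=(x_{k+1}-x_k)(x_{k+1}+x_k+\beta_{k+1})$, $B_k^{1,1}=(x_{k+1}+x_k+\beta_{k+1})(x_{k+1}+x_k+\beta_{k+1}+1)$, $b_k^0=(2x_k+\beta_k+1)(2x_k+\beta_k-1)$, $b_k^1=(2x_k+\beta_k+1)(2x_k+\beta_k)$; replacing an upper index $1$ by $-1$ means substituting $x_i\mapsto -x_i-\beta_i$ for the corresponding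 variable ($i=k$ for the first index, $i=k+1$ for the second). For $\nu\in\{0,\pm1\}^j$, with $\nu_k=0$ for $k=0$ and $k>j$, let $$C_\nu=2^{\#\{k:\,1\le k\le j,\ \nu_k=0\}}\;\prod_{k=0}^{j}B_k^{\nu_k,\nu_{k+1}}\Big/\prod_{k=1}^{j}b_k^{\nu_k},$$ and let $L_\nu(\beta_0,N;n,\gamma)$ be the result of substituting in $C_\nu$: $x_0=0$, $x_{p+1}=N$, $x_k=N_1^{p+1-k}+\gamma_1^{p+2-k}+N+p+1-k$ $(1\le k\le p)$, $\beta_k=-\gamma_1^{p+2-k}-(p+2-k)-2N+1$ $(1\le k\le p+1)$, with $\beta_0$ kept. Define $$\hat L_\nu(n;\gamma)=\lim_{N\to\infty}\frac1N\lim_{\beta_0\to\infty}\frac1{\beta_0}L_\nu(\beta_0,N;n,\gamma),\qquad \hat{\mathfrak L}^n_j=\sum_{0\ne\nu\in\{0,\pm1\}^j}\hat L_\nu(n;\gamma)\,(T_\nu-1),$$ where $(T_\nu F)(n)=F(n')$, $n'_m=n_m+\nu_{p+1-m}-\nu_{p+2-m}$. Call $\gamma$ *generic for $n$* if $2N_1^m+\gamma_1^{m+1}+m\notin\{-1,0,1\}$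 for $p+1-j\le m\le p$ (no denominator vanishes). **Theorem.** The polynomials $J_p(n;z;\gamma)$ are bispectral: (a) $\hat{\mathfrak L}^z_j J_p(n;z;\gamma)=\hat\mu_j(n)\,J_p(n;z;\gamma)$ with $\hat\mu_j(n)=-(n_1+\dots+n_j)(n_1+\dots+n_j+j+\gamma_1+\dots+\gamma_{j+1})$. (b) The two limits defining $\hat L_\nu(n;\gamma)$ exist for all $\gamma\in\mathbb R^{p+1}$ that are generic for $n$. If $\gamma$ is generic for $n$, or if $\gamma_i>-1$ for all $i$ (in which case $\hat L_\nu(n;\gamma)$ means the limit of $\hat L_\nu(n;\gamma')$ as $\gamma'\to\gamma$ through parameters generic for $n$, and this limit exists), then $$\hat{\mathfrak L}^n_j J_p(n;z;\gamma)=\hat\kappa_j(z)\,J_p(n;z;\gamma),\qquad \hat\kappa_j(z)=1-z_1-\dots-z_{p+1-j},$$ as an identity of polynomials in $z$, whatever values are assigned to $J_p$ at indices in $\mathbb Z^p\setminus\mathbb N_0^p$. -/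

import Mathlib

open Filter Topology

noncomputable section

namespace SimplexJacobi

/-! ### Sequences, partial sums, Pochhammer symbols

Vectors `(v_1, …, v_m)` are functions `v : Fin m → R`; the mathematical index `k` is the
element of `Fin m` with value `k - 1`. -/

/-- `v_1 + v_2 + ⋯ + v_k` (so `0` for `k = 0`). -/
def psum {R : Type*} [AddCommMonoid R] {m : ℕ} (v : Fin m → R) (k : ℕ) : R :=
  ∑ i : Fin m, if (i : ℕ) < k then v i else 0

/-- The Pochhammer symbol `(a)_n = a (a + 1) ⋯ (a + n - 1)`. -/
def poch (a : ℝ) (n : ℕ) : ℝ := ∏ i ∈ Finset.range n, (a + i)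

/-! ### The Jacobi polynomials in one variable and on the simplex -/

/-- The coefficient of `((1 - x) / 2) ^ i` in the Jacobi polynomial `P_n(x; α, β)`, that is
`(α+1)_n / n! * (-n)_i (n+α+β+1)_i / ((α+1)_i i!)`, written with
`(α+1)_n / (α+1)_i = (α+1+i)_{n-i}`. -/
def jacobiCoeff (n : ℕ) (α β : ℝ) (i : ℕ) : ℝ :=
  poch (-(n : ℝ)) i * poch (n + α + β + 1) i * poch (α + 1 + i) (n - i) /
    ((n.factorial : ℝ) * (i.factorial : ℝ))

/-- The Jacobi polynomial `P_n(x; α, β)` in one variable. -/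
def jacobiP (n : ℕ) (α β x : ℝ) : ℝ :=
  ∑ i ∈ Finset.range (n + 1), jacobiCoeff n α β i * ((1 - x) / 2) ^ i

/-- The polynomial `v ^ n * P_n(1 - 2 u / v; α, β)`. -/
def jacobiHom {p : ℕ} (n : ℕ) (α β : ℝ) (u v : MvPolynomial (Fin p) ℝ) :
    MvPolynomial (Fin p) ℝ :=
  ∑ i ∈ Finset.range (n + 1), MvPolynomial.C (jacobiCoeff n α β i) * u ^ i * v ^ (n - i)

/-- `Z_1^k = z_1 + ⋯ + z_k` for `k ≤ p`, and `Z_1^{p+1} = 1` (because `z_{p+1} = 1 - |z|`). -/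
def Zsum (p k : ℕ) : MvPolynomial (Fin p) ℝ :=
  if k ≤ p then psum (fun i : Fin p => MvPolynomial.X i) k else 1

/-- The multivariable Jacobi polynomial `J_p(n; z; γ)`:
`(-1)^|n| ∏_{k=1}^p n_k! (Z_1^{k+1})^{n_k} / (γ_{k+1}+1)_{n_k} *
  P_{n_k}(1 - 2 Z_1^k / Z_1^{k+1}; 2 N_1^{k-1} + γ_1^k + k - 1, γ_{k+1})`,
with `N_1^{k-1} = n_1 + ⋯ + n_{k-1}` and `γ_1^k = γ_1 + ⋯ + γ_k`. -/
def jacobiSimplex (p : ℕ) (γ : Fin (p + 1) → ℝ) (n : Fin p → ℕ) : MvPolynomial (Fin p) ℝ :=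
  MvPolynomial.C ((-1) ^ (∑ k, n k)) *
    ∏ k : Fin p,
      MvPolynomial.C (((n k).factorial : ℝ) / poch (γ k.succ + 1) (n k)) *
        jacobiHom (n k) (2 * ((psum n (k : ℕ) : ℕ) : ℝ) + psum γ ((k : ℕ) + 1) + (k : ℕ)) (γ k.succ)
          (Zsum p ((k : ℕ) + 1)) (Zsum p ((k : ℕ) + 2))

/-- `jacobiP` is the usual hypergeometric expression whenever the latter makes sense. -/
theorem jacobiP_eq (n : ℕ) (α β x : ℝ) (h : poch (α + 1) n ≠ 0) :
    jacobiP n α β x = poch (α + 1) n / n.factorial *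
      ∑ i ∈ Finset.range (n + 1), poch (-(n : ℝ)) i * poch (n + α + β + 1) i /
        (poch (α + 1) i * i.factorial) * ((1 - x) / 2) ^ i := by
  unfold jacobiP
  rw [Finset.mul_sum]
  refine Finset.sum_congr rfl fun i hi => ?_
  have hin : i ≤ n := Nat.lt_succ_iff.mp (Finset.mem_range.mp hi)
  have hsplit : poch (α + 1) n = poch (α + 1) i * poch (α + 1 + i) (n - i) := by
    unfold poch
    have h1 := Finset.prod_range_add (fun m : ℕ => α + 1 + (m : ℝ)) i (n - i)
    rw [Nat.add_sub_cancel' hin] at h1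
    rw [h1]
    congr 1
    refine Finset.prod_congr rfl fun m _ => ?_
    push_cast
    ring
  have hi0 : poch (α + 1) i ≠ 0 := fun h0 => h (by rw [hsplit, h0, zero_mul])
  unfold jacobiCoeff
  rw [hsplit]
  field_simp

/-- At a point where no `Z_1^{k+1}` vanishes, the value of `jacobiSimplex` is given by the product
formula for `J_p(n; z; γ)`. -/
theorem eval_jacobiSimplex (p : ℕ) (γ : Fin (p + 1) → ℝ) (n : Fin p → ℕ) (z : Fin p → ℝ)
    (hz : ∀ k : Fin p, MvPolynomial.eval z (Zsum p ((k : ℕ) + 2)) ≠ 0) :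
    MvPolynomial.eval z (jacobiSimplex p γ n) =
      (-1) ^ (∑ k, n k) *
        ∏ k : Fin p,
          ((n k).factorial : ℝ) * MvPolynomial.eval z (Zsum p ((k : ℕ) + 2)) ^ n k /
              poch (γ k.succ + 1) (n k) *
            jacobiP (n k) (2 * ((psum n (k : ℕ) : ℕ) : ℝ) + psum γ ((k : ℕ) + 1) + (k : ℕ)) (γ k.succ)
              (1 - 2 * (MvPolynomial.eval z (Zsum p ((k : ℕ) + 1)) /
                MvPolynomial.eval z (Zsum p ((k : ℕ) + 2)))) := by
  unfold jacobiSimplex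
  rw [map_mul, map_prod, MvPolynomial.eval_C]
  congr 1
  refine Finset.prod_congr rfl fun k _ => ?_
  rw [map_mul, MvPolynomial.eval_C, mul_div_right_comm, mul_assoc]
  congr 1
  unfold jacobiHom jacobiP
  rw [map_sum, Finset.mul_sum]
  refine Finset.sum_congr rfl fun i hi => ?_
  have hin : i ≤ n k := Nat.lt_succ_iff.mp (Finset.mem_range.mp hi)
  have hk := hz k
  simp only [map_mul, map_pow, MvPolynomial.eval_C]
  generalize MvPolynomial.eval z (Zsum p ((k : ℕ) + 2)) = v at hk
  generalize MvPolynomial.eval z (Zsum p ((k : ℕ) + 1)) = u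
  have h1 : (1 - (1 - 2 * (u / v))) / 2 = u / v := by ring
  have h2 : v ^ n k = v ^ i * v ^ (n k - i) := by rw [← pow_add, Nat.add_sub_cancel' hin]
  rw [h1, h2, div_pow]
  field_simp

/-! ### The second-order differential operators in `z` -/

/-- The operator `L_j^z`:
`-2 ∑_{l < m ≤ min(j+1,p)} z_l z_m ∂_l ∂_m + ∑_{m ≤ min(j+1,p)} z_m (Z_1^{j+1} - z_m) ∂_m²
  + ∑_{m ≤ min(j+1,p)} ((γ_m + 1) Z_1^{j+1} - (γ_1^{j+1} + j + 1) z_m) ∂_m`. -/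
def opZ (p j : ℕ) (γ : Fin (p + 1) → ℝ) (f : MvPolynomial (Fin p) ℝ) :
    MvPolynomial (Fin p) ℝ :=
  -2 * (∑ l : Fin p, ∑ m : Fin p, if l < m ∧ (m : ℕ) < j + 1 then
      MvPolynomial.X l * MvPolynomial.X m * MvPolynomial.pderiv l (MvPolynomial.pderiv m f)
      else 0)
  + (∑ m : Fin p, if (m : ℕ) < j + 1 then
      MvPolynomial.X m * (Zsum p (j + 1) - MvPolynomial.X m) *
        MvPolynomial.pderiv m (MvPolynomial.pderiv m f)
      else 0)
  + (∑ m : Fin p, if (m : ℕ) < j + 1 then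
      (MvPolynomial.C (γ m.castSucc + 1) * Zsum p (j + 1)
        - MvPolynomial.C (psum γ (j + 1) + j + 1) * MvPolynomial.X m) *
        MvPolynomial.pderiv m f
      else 0)

/-- `-(n_1 + ⋯ + n_j) (n_1 + ⋯ + n_j + j + γ_1 + ⋯ + γ_{j+1})`. -/
def muHat (p j : ℕ) (γ : Fin (p + 1) → ℝ) (n : Fin p → ℕ) : ℝ :=
  -((psum n j : ℕ) : ℝ) * (((psum n j : ℕ) : ℝ) + j + psum γ (j + 1))

/-- `1 - z_1 - z_2 - ⋯ - z_{p+1-j}` (used for `1 ≤ j ≤ p`). -/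
def kappaHat (p j : ℕ) : MvPolynomial (Fin p) ℝ :=
  1 - psum (fun i : Fin p => MvPolynomial.X i) (p + 1 - j)

/-! ### The coefficients of the Racah difference operators -/

/-- `B_i^{s,t}` as a function of `b = β_i`, `b' = β_{i+1}`, `x = x_i`, `x' = x_{i+1}`. A negative
index is obtained from a positive one by the involution `x ↦ -x - b`, resp. `x' ↦ -x' - b'`. -/
def racahB (b b' x x' : ℝ) : SignType → SignType → ℝ
  | .zero, .zero => x * (x + b) + x' * (x' + b') + (b + 1) * (b' - 1) / 2
  | .zero, .pos => B01 x x'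
  | .pos, .zero => B10 x x'
  | .pos, .pos => B11 x x'
  | .neg, .zero => B10 (-x - b) x'
  | .neg, .pos => B11 (-x - b) x'
  | .zero, .neg => B01 x (-x' - b')
  | .pos, .neg => B11 x (-x' - b')
  | .neg, .neg => B11 (-x - b) (-x' - b')
where
  B01 (x x' : ℝ) : ℝ := (x' + x + b') * (x' - x + b' - b)
  B10 (x x' : ℝ) : ℝ := (x' - x) * (x' + x + b')
  B11 (x x' : ℝ) : ℝ := (x' + x + b') * (x' + x + b' + 1)

/-- `b_i^s` as a function of `b = β_i`, `x = x_i`. -/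
def racahb (b x : ℝ) : SignType → ℝ
  | .zero => (2 * x + b + 1) * (2 * x + b - 1)
  | .pos => (2 * x + b + 1) * (2 * x + b)
  | .neg => (2 * (-x - b) + b + 1) * (2 * (-x - b) + b)

/-- The entry `ν_k` of `ν = (ν_1, …, ν_j)`, with `ν_k = 0` for `k = 0` and for `k > j`. -/
def entry {j : ℕ} (ν : Fin j → SignType) (k : ℕ) : SignType :=
  if h : 1 ≤ k ∧ k ≤ j then ν ⟨k - 1, by omega⟩ else 0

/-- `C_ν^{(j)} = 2^{j - |ν⁺| - |ν⁻|} ∏_{k=0}^j B_k^{ν_k,ν_{k+1}} / ∏_{k=1}^j b_k^{ν_k}`, the coefficient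
of `E_x^ν` in the Racah operator of order `j`, as a function of the sequences `β` and `x`. -/
def racahC {j : ℕ} (β x : ℕ → ℝ) (ν : Fin j → SignType) : ℝ :=
  2 ^ (Finset.univ.filter fun i => ν i = 0).card *
    (∏ k ∈ Finset.range (j + 1),
      racahB (β k) (β (k + 1)) (x k) (x (k + 1)) (entry ν k) (entry ν (k + 1))) /
    ∏ k ∈ Finset.Icc 1 j, racahb (β k) (x k) (entry ν k)

/-! ### The dual operators in `n` and their limits -/

/-- The Hahn parametrization `β_k = β_0 + γ_1^k + k`. -/
def hahnBeta {p : ℕ} (γ : Fin (p + 1) → ℝ) (β₀ : ℝ) (k : ℕ) : ℝ := β₀ + psum γ k + k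

/-- The images of `β_0, …, β_{p+1}` under the duality map: `β_0 ↦ β_0` and
`β_k ↦ β_0 - β_{p+2-k} - 2 N + 1` for `1 ≤ k ≤ p + 1`. -/
def dualBeta {p : ℕ} (γ : Fin (p + 1) → ℝ) (β₀ N : ℝ) (k : ℕ) : ℝ :=
  if k = 0 then β₀ else β₀ - hahnBeta γ β₀ (p + 2 - k) - 2 * N + 1

/-- The images of `x_0 = 0`, of `x_1, …, x_p` and of `x_{p+1} = N` under the duality map:
`x_k ↦ n_1 + ⋯ + n_{p+1-k} + β_{p+2-k} - β_0 + N - 1` for `1 ≤ k ≤ p`. -/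
def dualX {p : ℕ} (γ : Fin (p + 1) → ℝ) (β₀ N : ℝ) (n : Fin p → ℕ) (k : ℕ) : ℝ :=
  if k = 0 then 0
  else if k = p + 1 then N
  else ((psum n (p + 1 - k) : ℕ) : ℝ) + hahnBeta γ β₀ (p + 2 - k) - β₀ + N - 1

/-- The coefficient of the dual Racah operator `L_j^n(β_0, γ, N)` at the dual of the shift `E_x^ν`. -/
def coeffRacah (p j : ℕ) (γ : Fin (p + 1) → ℝ) (β₀ N : ℝ) (n : Fin p → ℕ)
    (ν : Fin j → SignType) : ℝ :=
  racahC (dualBeta γ β₀ N) (dualX γ β₀ N n) ν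

/-- The corresponding coefficient in the Hahn case, `lim_{β_0 → ∞} (1/β_0) coeffRacah`. -/
def coeffHahn (p j : ℕ) (γ : Fin (p + 1) → ℝ) (N : ℝ) (n : Fin p → ℕ)
    (ν : Fin j → SignType) : ℝ :=
  limUnder atTop fun β₀ : ℝ => coeffRacah p j γ β₀ N n ν / β₀

/-- The corresponding coefficient in the Jacobi case, `lim_{N → ∞} (1/N) coeffHahn`. -/
def coeffJacobi (p j : ℕ) (γ : Fin (p + 1) → ℝ) (n : Fin p → ℕ) (ν : Fin j → SignType) : ℝ :=
  limUnder atTop fun N : ℝ => coeffHahn p j γ N n ν / N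

/-- The parameters `γ` for which no denominator in the coefficients of the operator of order `j`
vanishes at `n`: the factors of the dual `b_k^s`, `1 ≤ k ≤ j`, are up to sign
`2 N_1^m + γ_1^{m+1} + m + ε` with `m = p + 1 - k` and `ε ∈ {-1, 0, 1}`. -/
def genericParams (p j : ℕ) (n : Fin p → ℕ) : Set (Fin (p + 1) → ℝ) :=
  {γ | ∀ m : ℕ, p + 1 - j ≤ m → m ≤ p → ∀ ε : SignType,
    2 * ((psum n m : ℕ) : ℝ) + psum γ (m + 1) + m + (ε : ℝ) ≠ 0}

/-- The value at `n` of the coefficient of the operator `L_j^n` as a rational function with its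
removable singularities in `γ` removed: the limit of `coeffJacobi` along generic parameters
(it is `coeffJacobi` itself when `γ` is generic). -/
def coeffN (p j : ℕ) (γ : Fin (p + 1) → ℝ) (n : Fin p → ℕ) (ν : Fin j → SignType) : ℝ :=
  limUnder (𝓝[genericParams p j n] γ) fun γ' => coeffJacobi p j γ' n ν

/-- The point `n` moved by the dual of `E_x^ν`. Since `E_{x_k}` is sent to
`E_{n_{p+1-k}} E_{n_{p+2-k}}⁻¹` (with `E_{n_{p+1}} = 1`), the coordinate `n_m` becomes
`n_m + ν_{p+1-m} - ν_{p+2-m}`. -/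
def dualShift {p j : ℕ} (ν : Fin j → SignType) (n : Fin p → ℕ) : Fin p → ℤ := fun m =>
  (n m : ℤ) + (entry ν (p - (m : ℕ)) : ℤ) - (entry ν (p + 1 - (m : ℕ)) : ℤ)

/-- The difference operator `L_j^n = ∑_{ν ≠ 0} coeffN_ν (dual(E_x^ν) - 1)` applied to a function `F`
of `n ∈ ℤ^p` with polynomial values, evaluated at `n ∈ ℕ^p`. -/
def opN (p j : ℕ) (γ : Fin (p + 1) → ℝ) (F : (Fin p → ℤ) → MvPolynomial (Fin p) ℝ)
    (n : Fin p → ℕ) : MvPolynomial (Fin p) ℝ :=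
  ∑ ν : Fin j → SignType, if ν = 0 then 0 else
    MvPolynomial.C (coeffN p j γ n ν) * (F (dualShift ν n) - F fun i => (n i : ℤ))

end SimplexJacobi

end

open SimplexJacobi

/-!
Up to a constant, the factor of `J_p(n; z; γ)` with the variable `Z_1^k / Z_1^{k+1}` depends only
on the partial sums `N_1^{k-1}` and `N_1^k`, so `J_p` is a product of local weights along the chain
of partial sums, and both operators can be treated one level at a time.

For the difference equation, `1 - κ̂_j = Z_1^{p+1-j}` is the telescoping product of the quotients
`Z_1^k / Z_1^{k+1}` with `p + 1 - j ≤ k ≤ p`. Multiplying one factor by its variable and changing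
the parameters to those required by a shift of `N_1^{k-1}` by `0` or `±1` gives, by the contiguity
relations of `₂F₁`, a combination of the same factor with `N_1^k` shifted by `0` or `±1`. Chaining
these expansions writes `Z_1^{p+1-j} J_p` as a sum over `ν` of products of local coefficients,
which turn out to be minus the limits of the Racah coefficients. Evaluating at `z = (1, 0, …, 0)`,
where every `J_p` is `1`, shows that the products sum to `1`; this accounts for the `-1` in
`T_ν - 1`. The contiguity coefficients have removable singularities at degree `0`, and replacing
them by their limits there extends the argument to parameters that are not generic.

For the differential equation, put `θ_j = ∑_{k ≤ j} Z_1^k ∂_{Z_1^k}` in the coordinates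
`Z_1^1, …, Z_1^p`. Then `Z_1^j 𝔏_j` is the sum of `Z_1^{j+1} 𝔏_{j-1}` and a second order polynomial
in `θ_j`. The factors of `J_p` below level `j` are homogeneous for `θ_j`, the ones above it are
constants for `θ_j`, and on the factor at level `j` the recursion becomes the hypergeometric
equation.
-/

namespace SimplexJacobi

section Pochhammer

theorem poch_zero (a : ℝ) : poch a 0 = 1 := Finset.prod_range_zero _

theorem poch_succ (a : ℝ) (n : ℕ) : poch a (n + 1) = poch a n * (a + n) :=
  Finset.prod_range_succ _ _

theorem poch_succ_left (a : ℝ) (n : ℕ) : poch a (n + 1) = a * poch (a + 1) n := by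
  simp only [poch, Finset.prod_range_succ', Nat.cast_zero, add_zero, Nat.cast_add, Nat.cast_one,
    add_assoc, add_comm (1 : ℝ), mul_comm a]

theorem poch_ne_zero {a : ℝ} (ha : ∀ i : ℕ, a + i ≠ 0) (n : ℕ) : poch a n ≠ 0 :=
  Finset.prod_ne_zero_iff.mpr fun i _ => ha i

theorem poch_neg_natCast_succ (n : ℕ) : poch (-(n : ℝ)) (n + 1) = 0 := by
  rw [poch_succ, neg_add_cancel, mul_zero]

theorem mul_poch_add_one (a : ℝ) (n : ℕ) : a * poch (a + 1) n = (a + n) * poch a n := by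
  rw [← poch_succ_left, poch_succ, mul_comm]

end Pochhammer

section NormalizedJacobi

/-- The coefficient of `u^i v^(n-i)` in `jacobiNorm u v d b n`. -/
noncomputable def jacobiNormCoeff (d b : ℝ) (n i : ℕ) : ℝ :=
  (-1) ^ n * (n.factorial / poch d n) * jacobiCoeff n (b - n - d) (d - 1) i

theorem jacobiNormCoeff_eq (d b : ℝ) (n i : ℕ) :
    jacobiNormCoeff d b n i = (-1) ^ n * poch (-(n : ℝ)) i * poch b i *
      poch (b - n - d + 1 + i) (n - i) / (poch d n * i.factorial) := by
  have hn := Nat.cast_ne_zero (R := ℝ).mpr n.factorial_ne_zero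
  rw [jacobiNormCoeff, jacobiCoeff, show (n : ℝ) + (b - n - d) + (d - 1) + 1 = b by ring]
  field_simp

theorem jacobiNormCoeff_self (d b : ℝ) (n : ℕ) :
    jacobiNormCoeff d b n n =
      (-1) ^ n * poch (-(n : ℝ)) n * poch b n / (poch d n * n.factorial) := by
  rw [jacobiNormCoeff_eq, Nat.sub_self, poch_zero, mul_one]

theorem jacobiNormCoeff_succ_self (d b : ℝ) (n : ℕ) : jacobiNormCoeff d b n (n + 1) = 0 := by
  rw [jacobiNormCoeff_eq, poch_neg_natCast_succ, mul_zero, zero_mul, zero_mul, zero_div]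

variable {d : ℝ}

theorem jacobiNormCoeff_raise_self (b : ℝ) (n : ℕ) :
    (b + n) * jacobiNormCoeff d b n n = b * jacobiNormCoeff d (b + 1) n n := by
  simp only [jacobiNormCoeff_self]
  linear_combination -(-1) ^ n * poch (-(n : ℝ)) n / (poch d n * n.factorial) * mul_poch_add_one b n

theorem jacobiNormCoeff_raise (hd : ∀ i : ℕ, d + i ≠ 0) (b : ℝ) {n i : ℕ} (hi : i ≤ n) :
    (b + (n + 1 : ℕ)) * jacobiNormCoeff d b (n + 1) i =
      b * jacobiNormCoeff d (b + 1) (n + 1) i + (n + 1 : ℕ) * jacobiNormCoeff d b n i := by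
  obtain ⟨r, rfl⟩ := Nat.exists_eq_add_of_le hi
  have hneg : ((i + r + 1 : ℕ) : ℝ) * poch (-((i + r : ℕ) : ℝ)) i =
      (r + 1) * poch (-((i + r + 1 : ℕ) : ℝ)) i := by
    have := mul_poch_add_one (-((i + r + 1 : ℕ) : ℝ)) i
    rw [show -((i + r + 1 : ℕ) : ℝ) + 1 = -((i + r : ℕ) : ℝ) by push_cast; ring] at this
    push_cast at this ⊢
    linear_combination -this
  have hb := mul_poch_add_one b i
  rw [jacobiNormCoeff_eq, jacobiNormCoeff_eq, jacobiNormCoeff_eq, show i + r + 1 - i = r + 1 by lia,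
    Nat.add_sub_cancel_left, poch_succ_left (b - _ - d + 1 + i) r,
    poch_succ (b + 1 - _ - d + 1 + i) r, poch_succ d, pow_succ]
  have hshift : b - ((i + r + 1 : ℕ) : ℝ) - d + 1 + i + 1 = b - ((i + r : ℕ) : ℝ) - d + 1 + i := by
    push_cast; ring
  have hshift' : b + 1 - ((i + r + 1 : ℕ) : ℝ) - d + 1 + i = b - ((i + r : ℕ) : ℝ) - d + 1 + i := by
    push_cast; ring
  rw [hshift, hshift']
  have hdn := hd (i + r)
  have hD := poch_ne_zero hd (i + r)
  have hfact : (i.factorial : ℝ) ≠ 0 := mod_cast i.factorial_ne_zero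
  field_simp
  generalize poch (b - _ - d + 1 + i) r = q, poch (-((i + r + 1 : ℕ) : ℝ)) i = x,
    poch (-((i + r : ℕ) : ℝ)) i = y at hneg ⊢
  push_cast at hneg ⊢
  linear_combination q * x * (b + 1 - d) * hb - q * poch b i * (d + i + r) * hneg

theorem jacobiNormCoeff_lower_zero (hd : ∀ i : ℕ, d + i ≠ 0) (b : ℝ) (n : ℕ) :
    (d + n) * jacobiNormCoeff d b (n + 1) 0 + (b - d) * jacobiNormCoeff d (b - 1) n 0 = 0 := by
  have hdn := hd n
  have hD := poch_ne_zero hd n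
  simp only [jacobiNormCoeff_eq, poch_zero, poch_succ d, poch_succ (b - _ - d + 1 + _),
    Nat.sub_zero, Nat.factorial_zero, Nat.cast_zero, pow_succ]
  rw [show b - ((n + 1 : ℕ) : ℝ) - d + 1 + 0 = b - 1 - n - d + 1 + 0 by push_cast; ring]
  field_simp
  ring

theorem jacobiNormCoeff_lower (hd : ∀ i : ℕ, d + i ≠ 0) (b : ℝ) {n i : ℕ} (hi : i ≤ n) :
    (b + n) * jacobiNormCoeff d b n i = (d + n) * jacobiNormCoeff d b (n + 1) (i + 1) +
      (b - d) * jacobiNormCoeff d (b - 1) n (i + 1) := by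
  have hdn := hd n
  have hD := poch_ne_zero hd n
  have hfact : (i.factorial : ℝ) ≠ 0 := mod_cast i.factorial_ne_zero
  have hneg : poch (-((n + 1 : ℕ) : ℝ)) (i + 1) = -(n + 1) * poch (-(n : ℝ)) i := by
    rw [poch_succ_left, Nat.cast_succ, show -((n : ℝ) + 1) + 1 = -n by ring]
  have hb : poch (b - 1) (i + 1) = (b - 1) * poch b i := by rw [poch_succ_left, sub_add_cancel]
  obtain rfl | hlt := hi.eq_or_lt
  · rw [jacobiNormCoeff_self, jacobiNormCoeff_self, jacobiNormCoeff_succ_self, hneg,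
      Nat.factorial_succ, poch_succ d, poch_succ b, pow_succ]
    push_cast
    field_simp
    ring
  · have hr : ((n - (i + 1) : ℕ) : ℝ) = n - (i + 1) := by
      rw [Nat.cast_sub (Nat.succ_le_of_lt hlt), Nat.cast_succ]
    have hq : poch (b - n - d + 1 + i) (n - i) =
        poch (b - n - d + 1 + i) (n - (i + 1)) * (b - d) := by
      rw [show n - i = n - (i + 1) + 1 by lia, poch_succ, hr]
      ring
    simp only [jacobiNormCoeff_eq, hneg, hb, poch_succ d, poch_succ b, poch_succ (-_), pow_succ,
      Nat.factorial_succ, Nat.add_sub_add_right]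
    rw [show b - ((n + 1 : ℕ) : ℝ) - d + 1 + ((i + 1 : ℕ) : ℝ) = b - n - d + 1 + i by
        push_cast; ring,
      show b - 1 - (n : ℝ) - d + 1 + ((i + 1 : ℕ) : ℝ) = b - n - d + 1 + i by push_cast; ring, hq]
    push_cast
    field_simp
    ring

variable {p : ℕ} (u v : MvPolynomial (Fin p) ℝ)

/-- `(-1)^m m! / (d)_m * v^m P_m(1 - 2 u / v; b - m - d, d - 1)`, the factor of `J_p(n; z; γ)` of
degree `m`; it is `0` for `m < 0`. The parameter `b` is the one of `₂F₁(-m, b; ·)`. -/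
noncomputable def jacobiNorm (d b : ℝ) : ℤ → MvPolynomial (Fin p) ℝ
  | (n : ℕ) => MvPolynomial.C ((-1) ^ n * (n.factorial / poch d n)) *
      jacobiHom n (b - n - d) (d - 1) u v
  | Int.negSucc _ => 0

theorem jacobiNorm_natCast (d b : ℝ) (n : ℕ) :
    jacobiNorm u v d b n = ∑ i ∈ Finset.range (n + 1),
      MvPolynomial.C (jacobiNormCoeff d b n i) * (u ^ i * v ^ (n - i)) := by
  simp only [jacobiNorm, jacobiHom, jacobiNormCoeff, Finset.mul_sum, map_mul, mul_assoc]

theorem jacobiNorm_of_neg (d b : ℝ) {m : ℤ} (hm : m < 0) : jacobiNorm u v d b m = 0 := by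
  obtain ⟨n, rfl⟩ := Int.eq_negSucc_of_lt_zero hm
  rfl

theorem jacobiNorm_zero (d b : ℝ) : jacobiNorm u v d b 0 = 1 := by
  rw [← Nat.cast_zero, jacobiNorm_natCast]
  simp [jacobiNormCoeff_self, poch_zero]

theorem jacobiNorm_raise (hd : ∀ i : ℕ, d + i ≠ 0) (b : ℝ) (m : ℤ) :
    (b + m) • jacobiNorm u v d b m =
      b • jacobiNorm u v d (b + 1) m + (m : ℝ) • (v * jacobiNorm u v d b (m - 1)) := by
  rcases m with (_ | n) | n
  · simp [jacobiNorm_zero]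
  · have hcast : ((Int.ofNat (n + 1) : ℤ) : ℝ) = (n + 1 : ℕ) := rfl
    rw [hcast, show Int.ofNat (n + 1) - 1 = (n : ℤ) by simp, Int.ofNat_eq_natCast]
    simp only [jacobiNorm_natCast, ← MvPolynomial.C_mul', Finset.sum_range_succ _ (n + 1),
      mul_add, Finset.mul_sum, ← mul_assoc, ← map_mul, jacobiNormCoeff_raise_self]
    rw [add_right_comm, ← Finset.sum_add_distrib]
    congr 1
    refine Finset.sum_congr rfl fun i hi => ?_
    have hin := Finset.mem_range_succ_iff.mp hi
    rw [jacobiNormCoeff_raise hd b hin, Nat.succ_sub hin, pow_succ v]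
    simp only [map_add, map_mul]
    ring
  · simp [jacobiNorm]

theorem jacobiNorm_lower (hd : ∀ i : ℕ, d + i ≠ 0) (b : ℝ) {m : ℤ} (hm : 0 ≤ m) :
    (b + m) • (u * jacobiNorm u v d b m) =
      (d + m) • jacobiNorm u v d b (m + 1) + (b - d) • (v * jacobiNorm u v d (b - 1) m) := by
  lift m to ℕ using hm with n
  have hextend : v * jacobiNorm u v d (b - 1) n = ∑ i ∈ Finset.range (n + 2),
      MvPolynomial.C (jacobiNormCoeff d (b - 1) n i) * (u ^ i * v ^ (n + 1 - i)) := by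
    rw [jacobiNorm_natCast, Finset.sum_range_succ _ (n + 1), jacobiNormCoeff_succ_self, map_zero,
      zero_mul, add_zero, Finset.mul_sum]
    refine Finset.sum_congr rfl fun i hi => ?_
    rw [Nat.succ_sub (Finset.mem_range_succ_iff.mp hi), pow_succ]
    ring
  rw [hextend, show (n : ℤ) + 1 = (n + 1 : ℕ) from rfl, jacobiNorm_natCast, jacobiNorm_natCast,
    Int.cast_natCast]
  simp only [← MvPolynomial.C_mul', Finset.mul_sum, ← mul_assoc, ← map_mul]
  rw [← Finset.sum_add_distrib, Finset.sum_range_succ' _ (n + 1), ← add_mul, ← add_mul, ← map_add,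
    jacobiNormCoeff_lower_zero hd, map_zero, zero_mul, zero_mul, add_zero]
  refine Finset.sum_congr rfl fun i hi => ?_
  rw [← add_mul, ← add_mul, ← map_add,
    ← jacobiNormCoeff_lower hd b (Finset.mem_range_succ_iff.mp hi), Nat.add_sub_add_right, pow_succ,
    map_mul]
  ring

theorem eval_jacobiNorm_of_eval_eq_one (hd : ∀ i : ℕ, d + i ≠ 0) (b : ℝ) {m : ℤ} (hm : 0 ≤ m)
    {z : Fin p → ℝ} (hu : MvPolynomial.eval z u = 1) (hv : MvPolynomial.eval z v = 1) :
    MvPolynomial.eval z (jacobiNorm u v d b m) = 1 := by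
  lift m to ℕ using hm with n
  induction n generalizing b with
  | zero => rw [Nat.cast_zero, jacobiNorm_zero, map_one]
  | succ n ih =>
    have h := congrArg (MvPolynomial.eval z) (jacobiNorm_lower u v hd b n.cast_nonneg)
    simp only [map_add, map_mul, MvPolynomial.smul_eval, hu, hv, ih, mul_one, Int.cast_natCast] at h
    refine mul_left_cancel₀ (hd n) ?_
    rw [Nat.cast_succ]
    linear_combination -h

end NormalizedJacobi

section Contiguity

/-- The coefficients of the contiguity relations of `jacobiNorm`, indexed by the shift `s'` of the
partial sum below a level and the shift `s` of the partial sum above it: the degree `m` becomes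
`m + s - s'` and `b` becomes `b + s + s'`. -/
noncomputable def connCoeff (d b : ℝ) (m : ℤ) : SignType → SignType → ℝ
  | .zero, .zero => (b ^ 2 + m ^ 2 + d * (m - b + 1) - 1) / ((b + m + 1) * (b + m - 1))
  | .zero, .pos => b * (m + d) / ((b + m + 1) * (b + m))
  | .zero, .neg => (b - d) * m / ((b + m - 1) * (b + m))
  | .pos, .zero => 2 * b * m / ((b + m + 1) * (b + m - 1))
  | .pos, .pos => b * (b + 1) / ((b + m + 1) * (b + m))
  | .pos, .neg => m * (m - 1) / ((b + m - 1) * (b + m))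
  | .neg, .zero => 2 * (m + d) * (b - d) / ((b + m + 1) * (b + m - 1))
  | .neg, .pos => (m + d) * (m + d + 1) / ((b + m + 1) * (b + m))
  | .neg, .neg => (b - d) * (b - d - 1) / ((b + m - 1) * (b + m))

variable {p : ℕ} (u v : MvPolynomial (Fin p) ℝ) {d b : ℝ} {m : ℤ}

theorem jacobiNorm_contiguous_pos (hd : ∀ i : ℕ, d + i ≠ 0) (h0 : b + m ≠ 0)
    (hpos : b + m + 1 ≠ 0) (hneg : b + m - 1 ≠ 0) :
    jacobiNorm u v d b m = connCoeff d b m .pos .neg • (v ^ 2 * jacobiNorm u v d b (m - 2)) +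
      connCoeff d b m .pos .zero • (v * jacobiNorm u v d (b + 1) (m - 1)) +
      connCoeff d b m .pos .pos • jacobiNorm u v d (b + 2) m := by
  have step := jacobiNorm_raise u v hd b m
  have step_left := jacobiNorm_raise u v hd (b + 1) m
  have step_right := congrArg (v * ·) (jacobiNorm_raise u v hd b (m - 1))
  simp only [mul_add, mul_smul_comm, ← mul_assoc v v, ← pow_two, sub_sub, add_assoc,
    one_add_one_eq_two] at step step_left step_right ⊢
  linear_combination (norm := skip) (b + m)⁻¹ • step + (b / ((b + m) * (b + m + 1))) • step_left +
    (m / ((b + m) * (b + m - 1))) • step_right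
  simp only [connCoeff]
  match_scalars <;> field_simp <;> ring

theorem jacobiNorm_contiguous_zero (hd : ∀ i : ℕ, d + i ≠ 0) (hm : 0 ≤ m) (h0 : b + m ≠ 0)
    (hpos : b + m + 1 ≠ 0) (hneg : b + m - 1 ≠ 0) :
    u * jacobiNorm u v d b m =
      connCoeff d b m .zero .neg • (v ^ 2 * jacobiNorm u v d (b - 1) (m - 1)) +
      connCoeff d b m .zero .zero • (v * jacobiNorm u v d b m) +
      connCoeff d b m .zero .pos • jacobiNorm u v d (b + 1) (m + 1) := by
  have step := jacobiNorm_lower u v hd b hm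
  have step_left := jacobiNorm_raise u v hd b (m + 1)
  have step_right := congrArg (v * ·) (jacobiNorm_raise u v hd (b - 1) m)
  simp only [mul_add, mul_smul_comm, ← mul_assoc v v, ← pow_two, add_sub_cancel_right,
    sub_add_cancel] at step step_left step_right ⊢
  linear_combination (norm := skip) (b + m)⁻¹ • step +
    ((d + m) / ((b + m) * (b + m + 1))) • step_left +
    ((b - d) / ((b + m) * (b + m - 1))) • step_right
  simp only [connCoeff]
  match_scalars <;> field_simp <;> ring

theorem jacobiNorm_contiguous_neg (hd : ∀ i : ℕ, d + i ≠ 0) (hm : 0 ≤ m) (h0 : b + m ≠ 0)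
    (hpos : b + m + 1 ≠ 0) (hneg : b + m - 1 ≠ 0) :
    u ^ 2 * jacobiNorm u v d b m =
      connCoeff d b m .neg .neg • (v ^ 2 * jacobiNorm u v d (b - 2) m) +
      connCoeff d b m .neg .zero • (v * jacobiNorm u v d (b - 1) (m + 1)) +
      connCoeff d b m .neg .pos • jacobiNorm u v d b (m + 2) := by
  have step := congrArg (u * ·) (jacobiNorm_lower u v hd b hm)
  have step_left := jacobiNorm_lower u v hd b (Int.add_nonneg hm zero_le_one)
  have step_right := congrArg (v * ·) (jacobiNorm_lower u v hd (b - 1) hm)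
  simp only [mul_add, mul_smul_comm, ← mul_assoc v v, ← mul_assoc u u, mul_left_comm v u,
    ← pow_two, add_assoc, sub_sub, one_add_one_eq_two] at step step_left step_right ⊢
  linear_combination (norm := skip) (b + m)⁻¹ • step +
    ((d + m) / ((b + m) * (b + m + 1))) • step_left +
    ((b - d) / ((b + m) * (b + m - 1))) • step_right
  simp only [connCoeff]
  match_scalars <;> field_simp <;> ring

theorem sum_signType {M : Type*} [AddCommMonoid M] (f : SignType → M) :
    ∑ s, f s = f .neg + f .zero + f .pos := by
  have huniv : (Finset.univ : Finset SignType) = {.neg, .zero, .pos} := by decide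
  rw [huniv, Finset.sum_insert (by decide), Finset.sum_insert (by decide), Finset.sum_singleton,
    add_assoc]

theorem jacobiNorm_contiguous (hd : ∀ i : ℕ, d + i ≠ 0) (hm : 0 ≤ m)
    (hb : ∀ ε : SignType, b + m + ε ≠ 0) (s' : SignType) :
    u ^ (1 - (s' : ℤ)).toNat * jacobiNorm u v d b m =
      ∑ s : SignType, MvPolynomial.C (connCoeff d b m s' s) *
        (v ^ (1 - (s : ℤ)).toNat * jacobiNorm u v d (b + s + s') (m + s - s')) := by
  have hneg : b + m - 1 ≠ 0 := hb .neg
  have hzero : b + m ≠ 0 := by simpa using hb 0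
  have hpos : b + m + 1 ≠ 0 := hb .pos
  have exp_neg : (1 - ((.neg : SignType) : ℤ)).toNat = 2 := rfl
  have exp_zero : (1 - ((.zero : SignType) : ℤ)).toNat = 1 := rfl
  have exp_pos : (1 - ((.pos : SignType) : ℤ)).toNat = 0 := rfl
  simp only [sum_signType, MvPolynomial.C_mul', exp_neg, exp_zero, exp_pos]
  cases s'
  · convert jacobiNorm_contiguous_zero u v hd hm hzero hpos hneg using 5 <;>
      norm_num [SignType.cast, exp_zero, ← sub_eq_add_neg]
  · convert jacobiNorm_contiguous_neg u v hd hm hzero hpos hneg using 5 <;>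
      norm_num [SignType.cast, exp_neg, ← sub_eq_add_neg, sub_sub]; ring_nf
  · convert jacobiNorm_contiguous_pos u v hd hzero hpos hneg using 5 <;>
      norm_num [SignType.cast, exp_pos, add_assoc, sub_sub]; ring_nf

/-- `connCoeff` with its removable singularities at `m = 0` removed. -/
noncomputable def regConnCoeff (d b : ℝ) (m : ℤ) (s' s : SignType) : ℝ :=
  if m = 0 ∧ s' ≠ -1 then
    match s', s with
    | .zero, .zero => (b + 1 - d) / (b + 1)
    | .zero, .pos => d / (b + 1)
    | .pos, .pos => 1
    | _, _ => 0
  else connCoeff d b m s' s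

/-- The condition under which `regConnCoeff d b m s'` has no singularity at `b`. -/
def RegularStep (b : ℝ) (m : ℤ) (s' : SignType) : Prop :=
  if m = 0 ∧ s' ≠ -1 then b + 1 ≠ 0 else ∀ ε : SignType, b + m + ε ≠ 0

theorem regConnCoeff_eq_connCoeff (hb : ∀ ε : SignType, b + m + ε ≠ 0) (s' s : SignType) :
    regConnCoeff d b m s' s = connCoeff d b m s' s := by
  unfold regConnCoeff
  split_ifs with h
  · obtain ⟨rfl, hs'⟩ := h
    have hneg : b - 1 ≠ 0 := by simpa [← sub_eq_add_neg] using hb (-1)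
    have hzero : b ≠ 0 := by simpa using hb 0
    have hpos : b + 1 ≠ 0 := by simpa using hb 1
    cases s' <;> cases s <;> simp [connCoeff] at hs' ⊢ <;> field_simp
    ring
  · rfl

theorem regConnCoeff_eq_zero_of_add_lt (d b : ℝ) (hm : 0 ≤ m) {s' s : SignType}
    (h : m + s < s') : regConnCoeff d b m s' s = 0 := by
  unfold regConnCoeff
  split_ifs with h0
  · obtain ⟨rfl, hs'⟩ := h0
    cases s' <;> cases s <;> simp at h hs' ⊢
  · obtain rfl | rfl : m = 0 ∨ m = 1 := by
      cases s' <;> cases s <;> simp at h <;> lia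
    all_goals cases s' <;> cases s <;> simp [connCoeff] at h h0 ⊢

theorem jacobiNorm_contiguous_reg (hd : ∀ i : ℕ, d + i ≠ 0) (hm : 0 ≤ m) {s' : SignType}
    (hb : RegularStep b m s') :
    u ^ (1 - (s' : ℤ)).toNat * jacobiNorm u v d b m =
      ∑ s : SignType, MvPolynomial.C (regConnCoeff d b m s' s) *
        (v ^ (1 - (s : ℤ)).toNat * jacobiNorm u v d (b + s + s') (m + s - s')) := by
  unfold RegularStep at hb
  split_ifs at hb with h0
  · obtain ⟨rfl, hs'⟩ := h0
    simp only [sum_signType, MvPolynomial.C_mul', regConnCoeff]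
    cases s'
    · have hlower := congrArg ((b + 1)⁻¹ • ·) (jacobiNorm_lower u v hd (b + 1) le_rfl)
      simpa [jacobiNorm_zero, smul_smul, hb, inv_mul_eq_div, add_comm (d • _)] using hlower
    · simp at hs'
    · simp [jacobiNorm_zero]
  · simp only [regConnCoeff, if_neg h0, jacobiNorm_contiguous u v hd hm hb]

theorem continuousAt_regConnCoeff {X : Type*} [TopologicalSpace X] {d b : X → ℝ} {x : X}
    (hd : ContinuousAt d x) (hb : ContinuousAt b x) {s' : SignType} (s : SignType)
    (hreg : RegularStep (b x) m s') :
    ContinuousAt (fun y => regConnCoeff (d y) (b y) m s' s) x := by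
  unfold RegularStep at hreg
  unfold regConnCoeff
  split_ifs at hreg ⊢ with h0
  · cases s' <;> cases s <;> fun_prop (disch := assumption)
  · have hneg : b x + m - 1 ≠ 0 := hreg .neg
    have hzero : b x + m ≠ 0 := by simpa using hreg 0
    have hpos : b x + m + 1 ≠ 0 := hreg .pos
    cases s' <;> cases s <;> simp only [connCoeff] <;>
      fun_prop (disch := simp [*])

end Contiguity

section PartialSums

theorem psum_zero {R : Type*} [AddCommMonoid R] {m : ℕ} (v : Fin m → R) : psum v 0 = 0 := by
  simp only [psum, Nat.not_lt_zero, if_false, Finset.sum_const_zero]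

theorem psum_succ {R : Type*} [AddCommMonoid R] {m : ℕ} (v : Fin m → R) {k : ℕ} (hk : k < m) :
    psum v (k + 1) = psum v k + v ⟨k, hk⟩ := by
  have hsplit (i : Fin m) : (if (i : ℕ) < k + 1 then v i else 0) =
      (if (i : ℕ) < k then v i else 0) + if i = ⟨k, hk⟩ then v i else 0 := by
    obtain h | rfl | h := lt_trichotomy i ⟨k, hk⟩
    · simp [h.ne, Fin.lt_def.mp h, (Fin.lt_def.mp h).trans (Nat.lt_succ_self k)]
    · simp
    · simp [h.ne', (Fin.lt_def.mp h).not_gt, (Nat.succ_le_of_lt (Fin.lt_def.mp h)).not_gt]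
  simp only [psum, hsplit, Finset.sum_add_distrib, Finset.sum_ite_eq', Finset.mem_univ, if_true]

theorem psum_add_one_of_le {R : Type*} [AddCommMonoid R] {m k : ℕ} (v : Fin m → R) (hk : m ≤ k) :
    psum v (k + 1) = psum v k :=
  Finset.sum_congr rfl fun i _ => by rw [if_pos (by lia), if_pos (by lia)]

theorem psum_mono {m : ℕ} (v : Fin m → ℕ) : Monotone (psum v) := fun k l h =>
  Finset.sum_le_sum fun i _ => by split_ifs <;> lia

theorem psum_natCast {m : ℕ} (v : Fin m → ℕ) (k : ℕ) :
    psum (fun i => (v i : ℤ)) k = (psum v k : ℕ) := by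
  simp only [psum, Nat.cast_sum, Nat.cast_ite, Nat.cast_zero]

end PartialSums

section Paths

variable {S : Type*} {j : ℕ}

/-- The tuple `ν` followed by the constant `e`. -/
def extend (ν : Fin j → S) (e : S) (k : ℕ) : S :=
  if h : k < j then ν ⟨k, h⟩ else e

theorem extend_self (ν : Fin j → S) (e : S) : extend ν e j = e :=
  dif_neg (lt_irrefl j)

theorem extend_snoc_of_le (ν : Fin j → S) (s e : S) {k : ℕ} (hk : k ≤ j) :
    extend (Fin.snoc ν s : Fin (j + 1) → S) e k = extend ν s k := by
  unfold extend
  rw [dif_pos (Nat.lt_succ_of_le hk)]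
  split_ifs with h
  · exact Fin.snoc_castSucc (α := fun _ => S) s ν ⟨k, h⟩
  · obtain rfl : k = j := hk.antisymm (not_lt.mp h)
    exact Fin.snoc_last (α := fun _ => S) s ν

theorem prod_extend_snoc {R : Type*} [CommMonoid R] (W : ℕ → S → S → R) (ν : Fin j → S) (s e : S) :
    ∏ k ∈ Finset.range (j + 1), W k (extend (Fin.snoc ν s : Fin (j + 1) → S) e (k + 1))
        (extend (Fin.snoc ν s : Fin (j + 1) → S) e k) =
      (∏ k ∈ Finset.range j, W k (extend ν s (k + 1)) (extend ν s k)) * W j e s := by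
  rw [Finset.prod_range_succ, extend_self, extend_snoc_of_le ν s e le_rfl, extend_self]
  congr 1
  refine Finset.prod_congr rfl fun k hk => ?_
  have hkj := Finset.mem_range.mp hk
  rw [extend_snoc_of_le ν s e hkj, extend_snoc_of_le ν s e hkj.le]

/-- The transfer-matrix method. The local relations are only needed at the states that are reached
with nonzero weight, which `good` keeps track of. -/
theorem prod_mul_eq_sum_paths {R : Type*} [CommSemiring R] [Fintype S] (W : ℕ → S → S → R)
    (u : ℕ → S → R) (X : ℕ → R) (good : ℕ → S → Prop)
    (hrel : ∀ k < j, ∀ s', good (k + 1) s' → X k * u (k + 1) s' = ∑ s, W k s' s * u k s)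
    (hbad : ∀ k < j, ∀ s' s, good (k + 1) s' → ¬ good k s → W k s' s = 0) {e : S} (he : good j e) :
    (∏ k ∈ Finset.range j, X k) * u j e =
      ∑ ν : Fin j → S, (∏ k ∈ Finset.range j, W k (extend ν e (k + 1)) (extend ν e k)) *
        u 0 (extend ν e 0) := by
  induction j generalizing e with
  | zero => simp [extend]
  | succ j ih =>
    have hstep (s : S) : (∏ k ∈ Finset.range j, X k) * (W j e s * u j s) =
        ∑ ν : Fin j → S, ((∏ k ∈ Finset.range j, W k (extend ν s (k + 1)) (extend ν s k)) *
          W j e s) * u 0 (extend ν s 0) := by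
      by_cases hs : good j s
      · rw [mul_left_comm, ih (fun k hk => hrel k (hk.trans j.lt_succ_self))
          (fun k hk => hbad k (hk.trans j.lt_succ_self)) hs, Finset.mul_sum]
        exact Finset.sum_congr rfl fun ν _ => by ring
      · simp only [hbad j j.lt_succ_self e s he hs, zero_mul, mul_zero, Finset.sum_const_zero]
    rw [Finset.prod_range_succ, mul_assoc, hrel j j.lt_succ_self e he, Finset.mul_sum,
      ← (Fin.snocEquiv fun _ : Fin (j + 1) => S).sum_comp, Fintype.sum_prod_type]
    refine Finset.sum_congr rfl fun s _ => (hstep s).trans (Finset.sum_congr rfl fun ν _ => ?_)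
    change _ = (∏ k ∈ Finset.range (j + 1), W k
      (extend (Fin.snoc ν s : Fin (j + 1) → S) e (k + 1))
      (extend (Fin.snoc ν s : Fin (j + 1) → S) e k)) *
        u 0 (extend (Fin.snoc ν s : Fin (j + 1) → S) e 0)
    rw [prod_extend_snoc, extend_snoc_of_le ν s e j.zero_le]

theorem entry_succ (ν : Fin j → SignType) (k : ℕ) : entry ν (k + 1) = extend ν 0 k := by
  unfold entry extend
  by_cases h : k < j
  · rw [dif_pos ⟨k.succ_pos, h⟩, dif_pos h]
    rfl
  · rw [dif_neg (by lia), dif_neg h]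

theorem entry_zero (ν : Fin j → SignType) : entry ν 0 = 0 :=
  dif_neg (by lia)

theorem entry_of_lt (ν : Fin j → SignType) {k : ℕ} (hk : j < k) : entry ν k = 0 :=
  dif_neg (by lia)

theorem entry_zero_fun (k : ℕ) : entry (0 : Fin j → SignType) k = 0 := by
  simp [entry]

end Paths

section Factorization

variable {p : ℕ}

/-- `γ_1 + ⋯ + γ_{i+1} + i`. -/
def levelParam (γ : Fin (p + 1) → ℝ) (i : ℕ) : ℝ := psum γ (i + 1) + i

theorem levelParam_succ_sub (γ : Fin (p + 1) → ℝ) {i : ℕ} (hi : i < p) :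
    levelParam γ (i + 1) - levelParam γ i = γ (Fin.succ ⟨i, hi⟩) + 1 := by
  simp only [levelParam, psum_succ γ (Nat.succ_lt_succ hi), Fin.succ_mk]
  push_cast
  ring

/-- The factor of `J_p(n; z; γ)` with the variable `Z_1^{i+1} / Z_1^{i+2}`, in terms of the partial
sums `a = N_1^i` and `c = N_1^{i+1}`. -/
noncomputable def levelFactor (γ : Fin (p + 1) → ℝ) (i : ℕ) (a c : ℤ) :
    MvPolynomial (Fin p) ℝ :=
  jacobiNorm (Zsum p (i + 1)) (Zsum p (i + 2)) (levelParam γ (i + 1) - levelParam γ i)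
    (a + c + levelParam γ (i + 1)) (c - a)

/-- `J_p` extended by zero to indices in `ℤ^p`. -/
noncomputable def jacobiInt (γ : Fin (p + 1) → ℝ) (a : Fin p → ℤ) : MvPolynomial (Fin p) ℝ :=
  ∏ i ∈ Finset.range p, levelFactor γ i (psum a i) (psum a (i + 1))

theorem jacobiInt_natCast (γ : Fin (p + 1) → ℝ) (n : Fin p → ℕ) :
    jacobiInt γ (fun i => (n i : ℤ)) = jacobiSimplex p γ n := by
  unfold jacobiInt jacobiSimplex
  rw [← Finset.prod_pow_eq_pow_sum, map_prod, ← Finset.prod_mul_distrib, Finset.prod_range]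
  refine Finset.prod_congr rfl fun k _ => ?_
  have hsucc := psum_succ n k.2
  rw [levelFactor, levelParam_succ_sub γ k.2, psum_natCast, psum_natCast, hsucc, Nat.cast_add,
    add_sub_cancel_left]
  have hα : ((psum n k : ℕ) : ℝ) + ((psum n k : ℕ) + n k) + levelParam γ (k + 1) - n k -
      (γ k.succ + 1) = 2 * (psum n k : ℕ) + psum γ (k + 1) + k := by
    linear_combination levelParam_succ_sub γ k.2 + levelParam.eq_1 γ k
  simp only [jacobiNorm, map_mul, mul_assoc, add_sub_cancel_right, Int.cast_add, Int.cast_natCast,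
    Fin.eta, hα]

theorem eval_Zsum_single (hp : 0 < p) (k : ℕ) :
    MvPolynomial.eval (Pi.single ⟨0, hp⟩ 1) (Zsum p (k + 1)) = 1 := by
  unfold Zsum psum
  split_ifs
  · rw [map_sum, Finset.sum_eq_single ⟨0, hp⟩ (fun i _ hi => by split_ifs <;> simp [hi])
      (by simp)]
    simp
  · exact map_one _

theorem Zsum_ne_zero (hp : 0 < p) (k : ℕ) : Zsum p (k + 1) ≠ 0 := fun h => by
  simpa [h] using eval_Zsum_single hp k

end Factorization

section DifferenceEquation

variable {p j : ℕ} (γ : Fin (p + 1) → ℝ) (n : Fin p → ℕ)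

/-- The partial sum `N_1^{p-k}`: the shifts `ν` are indexed from the last level downwards. -/
def revSum (k : ℕ) : ℤ := (psum n (p - k) : ℕ)

/-- `γ_1 + ⋯ + γ_{p-k+1} + p - k`, the parameter that goes with `revSum n k`. -/
def revParam (k : ℕ) : ℝ := levelParam γ (p - k)

/-- The weight of a shift by `s'` of `N_1^{p-k-1}` and by `s` of `N_1^{p-k}` in the expansion of
`Z_1^{p-k} / Z_1^{p-k+1}` times the factor of `J_p` at this level. -/
noncomputable def stepWeight (k : ℕ) (s' s : SignType) : ℝ :=
  regConnCoeff (revParam γ k - revParam γ (k + 1)) (revSum n (k + 1) + revSum n k + revParam γ k)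
    (revSum n k - revSum n (k + 1)) s' s

/-- Up to sign, the coefficient of the shift `ν` in the difference operator. -/
noncomputable def pathWeight (ν : Fin j → SignType) : ℝ :=
  ∏ k ∈ Finset.range j, stepWeight γ n k (entry ν (k + 2)) (entry ν (k + 1))

/-- The condition under which no `pathWeight` at `n` has a singularity at `γ`. -/
def RegularParams (j : ℕ) : Prop :=
  ∀ k < j, if revSum n k = 0 then revParam γ k + 1 ≠ 0
    else ∀ ε : SignType, 2 * (revSum n k : ℝ) + revParam γ k + ε ≠ 0

variable {γ n}

theorem revSum_nonneg (k : ℕ) : 0 ≤ revSum n k := Int.natCast_nonneg _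

theorem revSum_succ_le (k : ℕ) : revSum n (k + 1) ≤ revSum n k :=
  Int.ofNat_le.mpr (psum_mono n (by lia))

theorem RegularParams.regularStep (hreg : RegularParams γ n j) {k : ℕ} (hk : k < j)
    {s' : SignType} (hs' : 0 ≤ revSum n (k + 1) + s') :
    RegularStep (revSum n (k + 1) + revSum n k + revParam γ k) (revSum n k - revSum n (k + 1))
      s' := by
  have hnonneg := revSum_nonneg (n := n) (k + 1)
  have hle := revSum_succ_le (n := n) k
  have h := hreg k hk
  unfold RegularStep
  split_ifs at h with hzero
  · have hsucc : revSum n (k + 1) = 0 := by lia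
    have hne : s' ≠ -1 := by
      rintro rfl
      rw [SignType.coe_neg_one] at hs'
      lia
    rw [if_pos ⟨by lia, hne⟩, hsucc, hzero]
    simpa using h
  · split_ifs with hm
    · rw [show revSum n (k + 1) = revSum n k by lia]
      simpa [two_mul] using h 1
    · intro ε
      convert h ε using 2
      push_cast
      ring

theorem levelFactor_rev {k : ℕ} (hk : k < p) (a c : ℤ) :
    levelFactor γ (p - (k + 1)) a c = jacobiNorm (Zsum p (p - k)) (Zsum p (p + 1 - k))
      (revParam γ k - revParam γ (k + 1)) (a + c + revParam γ k) (c - a) := by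
  unfold levelFactor revParam
  rw [show p - (k + 1) + 1 = p - k by lia, show p - (k + 1) + 2 = p + 1 - k by lia]

theorem Zsum_pow_mul_levelFactor (hγ : ∀ k : Fin p, ∀ i : ℕ, γ k.succ + 1 + i ≠ 0) (hjp : j ≤ p)
    (hreg : RegularParams γ n j) {k : ℕ} (hk : k < j) {s' : SignType}
    (hs' : 0 ≤ revSum n (k + 1) + s') :
    Zsum p (p - k) ^ (1 - (s' : ℤ)).toNat *
        levelFactor γ (p - (k + 1)) (revSum n (k + 1)) (revSum n k) =
      ∑ s : SignType, MvPolynomial.C (stepWeight γ n k s' s) *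
        (Zsum p (p + 1 - k) ^ (1 - (s : ℤ)).toNat *
          levelFactor γ (p - (k + 1)) (revSum n (k + 1) + s') (revSum n k + s)) := by
  have hkp := hk.trans_le hjp
  have hd (i : ℕ) : revParam γ k - revParam γ (k + 1) + i ≠ 0 := by
    have hlevel := levelParam_succ_sub γ (show p - (k + 1) < p by lia)
    rw [show p - (k + 1) + 1 = p - k by lia] at hlevel
    rw [revParam, revParam, hlevel]
    exact hγ _ i
  simp only [levelFactor_rev hkp]
  rw [jacobiNorm_contiguous_reg _ _ hd (sub_nonneg.mpr (revSum_succ_le k))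
    (hreg.regularStep hk hs')]
  refine Finset.sum_congr rfl fun s _ => ?_
  rw [stepWeight]
  congr 3
  · simp; ring
  · ring

theorem prod_levelFactor_mul_Zsum (hγ : ∀ k : Fin p, ∀ i : ℕ, γ k.succ + 1 + i ≠ 0)
    (hjp : j ≤ p) (hreg : RegularParams γ n j) :
    (∏ k ∈ Finset.range j, levelFactor γ (p - (k + 1)) (revSum n (k + 1)) (revSum n k)) *
        Zsum p (p + 1 - j) =
      ∑ ν : Fin j → SignType, MvPolynomial.C (pathWeight γ n ν) *
        ∏ k ∈ Finset.range j, levelFactor γ (p - (k + 1)) (revSum n (k + 1) + entry ν (k + 2))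
          (revSum n k + entry ν (k + 1)) := by
  have hpaths := prod_mul_eq_sum_paths
    (W := fun k s' s => MvPolynomial.C (stepWeight γ n k s' s) *
      levelFactor γ (p - (k + 1)) (revSum n (k + 1) + s') (revSum n k + s))
    (u := fun k s => Zsum p (p + 1 - k) ^ (1 - (s : ℤ)).toNat)
    (X := fun k => levelFactor γ (p - (k + 1)) (revSum n (k + 1)) (revSum n k))
    (good := fun k s => 0 ≤ revSum n k + s) (j := j) (e := 0)
    (fun k hk s' hs' => by
      rw [mul_comm, Nat.add_sub_add_right, Zsum_pow_mul_levelFactor hγ hjp hreg hk hs']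
      exact Finset.sum_congr rfl fun s _ => by ring)
    (fun k _ s' s hs' hs => by
      rw [levelFactor, jacobiNorm_of_neg _ _ _ _ (by lia), mul_zero])
    (by simpa using revSum_nonneg j)
  have hone : Zsum p (p + 1) = 1 := if_neg (by lia)
  simpa [hone, Finset.prod_mul_distrib, ← entry_succ, pathWeight] using hpaths

theorem prod_range_eq_mul_prod_rev {R : Type*} [CommMonoid R] (f : ℕ → R) (hjp : j ≤ p) :
    ∏ i ∈ Finset.range p, f i =
      (∏ k ∈ Finset.range j, f (p - (k + 1))) * ∏ i ∈ Finset.range (p - j), f i := by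
  obtain ⟨r, rfl⟩ := Nat.exists_eq_add_of_le hjp
  rw [add_comm j, Finset.prod_range_add, Nat.add_sub_cancel, mul_comm,
    ← Finset.prod_range_reflect _ j]
  congr 1
  refine Finset.prod_congr rfl fun k hk => ?_
  have := Finset.mem_range.mp hk
  congr 1
  lia

theorem psum_dualShift (hjp : j ≤ p) (ν : Fin j → SignType) {i : ℕ} (hi : i ≤ p) :
    psum (dualShift ν n) i = (psum n i : ℕ) + (entry ν (p + 1 - i) : ℤ) := by
  induction i with
  | zero => simp [psum_zero, entry_of_lt ν (Nat.lt_succ_of_le hjp)]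
  | succ i ih =>
    rw [psum_succ _ hi, psum_succ n hi, ih (Nat.le_of_succ_le hi), dualShift,
      Nat.add_sub_add_right]
    push_cast
    ring

theorem jacobiInt_dualShift (hjp : j ≤ p) (ν : Fin j → SignType) :
    jacobiInt γ (dualShift ν n) =
      (∏ k ∈ Finset.range j, levelFactor γ (p - (k + 1)) (revSum n (k + 1) + entry ν (k + 2))
        (revSum n k + entry ν (k + 1))) *
      ∏ i ∈ Finset.range (p - j), levelFactor γ i (psum n i : ℕ) (psum n (i + 1) : ℕ) := by
  rw [jacobiInt, prod_range_eq_mul_prod_rev _ hjp]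
  congr 1 <;> refine Finset.prod_congr rfl fun k hk => ?_ <;>
    have hk := Finset.mem_range.mp hk <;>
    rw [psum_dualShift hjp ν (by lia), psum_dualShift hjp ν (by lia)]
  · rw [revSum, revSum, show p - (k + 1) + 1 = p - k by lia,
      show p + 1 - (p - (k + 1)) = k + 2 by lia, show p + 1 - (p - k) = k + 1 by lia]
  · rw [entry_of_lt ν (by lia), entry_of_lt ν (by lia), SignType.coe_zero, add_zero, add_zero]

theorem dualShift_zero : dualShift (0 : Fin j → SignType) n = fun i => (n i : ℤ) := by
  funext i
  simp [dualShift, entry_zero_fun]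

theorem sum_pathWeight_mul_jacobiInt (hγ : ∀ k : Fin p, ∀ i : ℕ, γ k.succ + 1 + i ≠ 0)
    (hjp : j ≤ p) (hreg : RegularParams γ n j) :
    ∑ ν : Fin j → SignType, MvPolynomial.C (pathWeight γ n ν) * jacobiInt γ (dualShift ν n) =
      Zsum p (p + 1 - j) * jacobiSimplex p γ n := by
  have hzero := jacobiInt_dualShift (γ := γ) (n := n) hjp 0
  simp only [dualShift_zero, jacobiInt_natCast, entry_zero_fun, SignType.coe_zero, add_zero]
    at hzero
  simp only [hzero, jacobiInt_dualShift hjp, ← mul_assoc, ← Finset.sum_mul,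
    ← prod_levelFactor_mul_Zsum hγ hjp hreg]
  ring

theorem pathWeight_eq_zero_of_not_nonneg {ν : Fin j → SignType} (hν : ¬ 0 ≤ dualShift ν n) :
    pathWeight γ n ν = 0 := by
  obtain ⟨i, hi⟩ : ∃ i, dualShift ν n i < 0 := by simpa [Pi.le_def] using hν
  obtain ⟨k, hk⟩ : ∃ k, p = i + 1 + k := Nat.exists_eq_add_of_le i.2
  rw [dualShift, show p - (i : ℕ) = k + 1 by lia, show p + 1 - (i : ℕ) = k + 2 by lia] at hi
  have hkj : k < j := by
    by_contra! hjk
    rw [entry_of_lt ν (by lia), entry_of_lt ν (by lia), add_sub_cancel_right] at hi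
    exact absurd hi (Int.natCast_nonneg _).not_gt
  have hdiff : revSum n k - revSum n (k + 1) = n i := by
    rw [revSum, revSum, show p - k = i + 1 by lia, show p - (k + 1) = i by lia, psum_succ n i.2]
    push_cast
    ring
  refine Finset.prod_eq_zero (Finset.mem_range.mpr hkj) ?_
  rw [stepWeight, hdiff]
  exact regConnCoeff_eq_zero_of_add_lt _ _ (Int.natCast_nonneg _) (sub_neg.mp hi)

theorem pathWeight_mul_eq (F : (Fin p → ℤ) → MvPolynomial (Fin p) ℝ)
    (hF : ∀ m : Fin p → ℕ, F (fun i => (m i : ℤ)) = jacobiSimplex p γ m) (ν : Fin j → SignType) :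
    MvPolynomial.C (pathWeight γ n ν) * F (dualShift ν n) =
      MvPolynomial.C (pathWeight γ n ν) * jacobiInt γ (dualShift ν n) := by
  by_cases hν : 0 ≤ dualShift ν n
  · lift dualShift ν n to Fin p → ℕ using hν with q
    rw [hF q, jacobiInt_natCast]
  · rw [pathWeight_eq_zero_of_not_nonneg hν, map_zero, zero_mul, zero_mul]

theorem eval_jacobiSimplex_single (hγ : ∀ k : Fin p, ∀ i : ℕ, γ k.succ + 1 + i ≠ 0) (hp : 0 < p)
    (m : Fin p → ℕ) :
    MvPolynomial.eval (Pi.single ⟨0, hp⟩ 1) (jacobiSimplex p γ m) = 1 := by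
  rw [← jacobiInt_natCast, jacobiInt, map_prod]
  refine Finset.prod_eq_one fun i hi => eval_jacobiNorm_of_eval_eq_one _ _ (fun k => ?_) _ ?_
    (eval_Zsum_single hp i) (eval_Zsum_single hp (i + 1))
  · rw [levelParam_succ_sub γ (Finset.mem_range.mp hi)]
    exact hγ _ k
  · rw [psum_natCast, psum_natCast]
    exact sub_nonneg.mpr (Int.ofNat_le.mpr (psum_mono m i.le_succ))

theorem sum_pathWeight (hγ : ∀ k : Fin p, ∀ i : ℕ, γ k.succ + 1 + i ≠ 0) (hp : 0 < p)
    (hjp : j ≤ p) (hreg : RegularParams γ n j) :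
    ∑ ν : Fin j → SignType, pathWeight γ n ν = 1 := by
  have heval := congrArg (MvPolynomial.eval (Pi.single ⟨0, hp⟩ 1))
    (sum_pathWeight_mul_jacobiInt hγ hjp hreg)
  rw [map_sum, map_mul, eval_jacobiSimplex_single hγ hp, Nat.sub_add_comm hjp,
    eval_Zsum_single hp, mul_one] at heval
  rw [← heval]
  refine Finset.sum_congr rfl fun ν _ => ?_
  by_cases hν : 0 ≤ dualShift ν n
  · lift dualShift ν n to Fin p → ℕ using hν with m
    rw [map_mul, jacobiInt_natCast, eval_jacobiSimplex_single hγ hp, MvPolynomial.eval_C, mul_one]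
  · rw [pathWeight_eq_zero_of_not_nonneg hν, map_zero, zero_mul, map_zero]

end DifferenceEquation

section Limits

/-- The sign by which the Racah coefficients at the two ends of a level differ from `connCoeff`. -/
def gaugeSign : SignType → ℝ
  | .zero => 1
  | _ => -1

theorem gaugeSign_mul_self (s : SignType) : gaugeSign s * gaugeSign s = 1 := by
  cases s <;> simp [gaugeSign]

theorem prod_gaugeSign (σ : ℕ → SignType) (j : ℕ) :
    ∏ k ∈ Finset.range j, gaugeSign (σ (k + 1)) * gaugeSign (σ k) =
      gaugeSign (σ j) * gaugeSign (σ 0) := by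
  induction j with
  | zero => simp [gaugeSign_mul_self]
  | succ j ih =>
    rw [Finset.prod_range_succ, ih]
    linear_combination (gaugeSign (σ (j + 1)) * gaugeSign (σ 0)) * gaugeSign_mul_self (σ j)

theorem racahB_div_racahb (a c : ℤ) (g h N : ℝ) (s s' : SignType) :
    (if s = 0 then 2 else 1) * racahB (-h - 2 * N) (-g - 2 * N) (c + h + N) (a + g + N) s s' /
        racahb (-h - 2 * N) (c + h + N) s =
      gaugeSign s' * gaugeSign s * connCoeff (h - g) (a + c + h) (c - a) s' s := by
  cases s <;> cases s' <;>
    simp [racahB, racahB.B01, racahB.B10, racahB.B11, racahb, connCoeff, gaugeSign] <;> ring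

theorem racahB_zero_invol (b b' x x' : ℝ) (s : SignType) :
    racahB b b' x (-x' - b') s 0 = racahB b b' x x' s 0 := by
  cases s <;> simp only [racahB, racahB.B10] <;> ring

variable {p j : ℕ} {γ : Fin (p + 1) → ℝ} {n : Fin p → ℕ}

theorem dualBeta_succ (γ : Fin (p + 1) → ℝ) (β₀ N : ℝ) {k : ℕ} (hk : k ≤ p) :
    dualBeta γ β₀ N (k + 1) = -revParam γ k - 2 * N := by
  unfold dualBeta hahnBeta revParam levelParam
  rw [if_neg k.succ_ne_zero, show p + 2 - (k + 1) = p - k + 1 by lia]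
  push_cast
  ring

theorem dualX_succ (γ : Fin (p + 1) → ℝ) (β₀ N : ℝ) (n : Fin p → ℕ) {k : ℕ} (hk : k < p) :
    dualX γ β₀ N n (k + 1) = revSum n k + revParam γ k + N := by
  unfold dualX hahnBeta revSum revParam levelParam
  rw [if_neg k.succ_ne_zero, if_neg (by lia), show p + 2 - (k + 1) = p - k + 1 by lia,
    show p + 1 - (k + 1) = p - k by lia]
  push_cast
  ring

theorem two_mul_revSum_add_ne_zero (hjp : j ≤ p) (hγ : γ ∈ genericParams p j n) {k : ℕ}
    (hk : k < j) (ε : SignType) : 2 * (revSum n k : ℝ) + revParam γ k + ε ≠ 0 := by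
  have hne := hγ (p - k) (by lia) (by lia) ε
  rwa [add_assoc (2 * _)] at hne

/-- The last dual variable `x_{p+1} = N` is the image of `x_{p+1} = γ_1 + N`, to which the formula
for the other variables specializes, under the involution `x ↦ -x - β_{p+1}`. -/
theorem racahB_dualX_succ (γ : Fin (p + 1) → ℝ) (β₀ N : ℝ) {k : ℕ} (hjp : j ≤ p) (hk : k < j)
    (ν : Fin j → SignType) (b x : ℝ) (s : SignType) :
    racahB b (dualBeta γ β₀ N (k + 2)) x (dualX γ β₀ N n (k + 2)) s (entry ν (k + 2)) =
      racahB b (-revParam γ (k + 1) - 2 * N) x (revSum n (k + 1) + revParam γ (k + 1) + N) s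
        (entry ν (k + 2)) := by
  rw [dualBeta_succ γ β₀ N (by lia)]
  obtain hlt | rfl : k + 1 < p ∨ p = k + 1 := by lia
  · rw [dualX_succ γ β₀ N n hlt]
  · rw [entry_of_lt ν (by lia), ← racahB_zero_invol]
    congr 1
    simp only [dualX, revSum, Nat.sub_self, psum_zero, Nat.succ_ne_zero, if_true, if_false,
      Nat.cast_zero, Int.cast_zero]
    ring

theorem racahLevel_eq (hjp : j ≤ p) (hγ : γ ∈ genericParams p j n) (β₀ N : ℝ)
    (ν : Fin j → SignType) {k : ℕ} (hk : k < j) :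
    (if entry ν (k + 1) = 0 then 2 else 1) *
        racahB (dualBeta γ β₀ N (k + 1)) (dualBeta γ β₀ N (k + 2)) (dualX γ β₀ N n (k + 1))
          (dualX γ β₀ N n (k + 2)) (entry ν (k + 1)) (entry ν (k + 2)) /
        racahb (dualBeta γ β₀ N (k + 1)) (dualX γ β₀ N n (k + 1)) (entry ν (k + 1)) =
      gaugeSign (entry ν (k + 2)) * gaugeSign (entry ν (k + 1)) *
        stepWeight γ n k (entry ν (k + 2)) (entry ν (k + 1)) := by
  rw [racahB_dualX_succ γ β₀ N hjp hk, dualBeta_succ γ β₀ N (by lia),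
    dualX_succ γ β₀ N n (by lia), racahB_div_racahb, stepWeight, regConnCoeff_eq_connCoeff]
  intro ε
  convert two_mul_revSum_add_ne_zero hjp hγ hk ε using 2
  push_cast
  ring

theorem two_pow_card_filter_eq_zero (ν : Fin j → SignType) :
    (2 : ℝ) ^ (Finset.univ.filter fun i => ν i = 0).card =
      ∏ k ∈ Finset.range j, if entry ν (k + 1) = 0 then 2 else 1 := by
  rw [← Finset.prod_const, Finset.prod_filter, Finset.prod_range]
  refine Finset.prod_congr rfl fun i _ => ?_
  rw [entry_succ, extend, dif_pos i.2]

theorem coeffRacah_eq (hjp : j ≤ p) (hγ : γ ∈ genericParams p j n) (β₀ N : ℝ)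
    (ν : Fin j → SignType) :
    coeffRacah p j γ β₀ N n ν =
      racahB β₀ (dualBeta γ β₀ N 1) 0 (dualX γ β₀ N n 1) 0 (entry ν 1) *
        (gaugeSign (entry ν 1) * pathWeight γ n ν) := by
  have hIcc (f : ℕ → ℝ) : ∏ k ∈ Finset.Icc 1 j, f k = ∏ k ∈ Finset.range j, f (k + 1) := by
    rw [Finset.range_eq_Ico, Finset.prod_Ico_add' f 0 j 1]
    rfl
  have hgauge := prod_gaugeSign (fun k => entry ν (k + 1)) j
  rw [entry_of_lt ν j.lt_succ_self, ← SignType.zero_eq_zero, gaugeSign, one_mul] at hgauge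
  have hlevels := Finset.prod_congr rfl fun k hk =>
    racahLevel_eq hjp hγ β₀ N ν (Finset.mem_range.mp hk)
  rw [Finset.prod_mul_distrib, hgauge, Finset.prod_div_distrib, Finset.prod_mul_distrib,
    ← two_pow_card_filter_eq_zero] at hlevels
  rw [pathWeight, ← hlevels, coeffRacah, racahC, hIcc, Finset.prod_range_succ', entry_zero]
  simp only [dualBeta, dualX, if_true]
  ring

/-- The leading coefficient in `β₀` of the first factor `B_0^{0,s}` of the Racah coefficients. -/
noncomputable def leadSlope (G c N : ℝ) : SignType → ℝ
  | .zero => -(G + 1) / 2 - N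
  | .pos => -c + N
  | .neg => c + G + N

theorem tendsto_affine_div (A B : ℝ) :
    Tendsto (fun x : ℝ => (A + B * x) / x) atTop (𝓝 B) := by
  have h : Tendsto (fun x : ℝ => A * x⁻¹ + B) atTop (𝓝 (A * 0 + B)) :=
    (tendsto_inv_atTop_zero.const_mul A).add_const B
  rw [mul_zero, zero_add] at h
  refine h.congr' ?_
  filter_upwards [eventually_ne_atTop 0] with x hx
  field_simp

theorem tendsto_racahB_first (G c N : ℝ) (s : SignType) :
    Tendsto (fun β₀ => racahB β₀ (-G - 2 * N) 0 (c + G + N) .zero s / β₀) atTop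
      (𝓝 (leadSlope G c N s)) := by
  have hlimit (A : ℝ) := tendsto_affine_div A (leadSlope G c N s)
  cases s <;> simp only [racahB, racahB.B01, leadSlope] at hlimit ⊢
  · refine (hlimit ((c + G + N) * (c - N) - (G + 2 * N + 1) / 2)).congr fun β₀ => ?_
    ring
  · refine (hlimit ((c + G + N) ^ 2)).congr fun β₀ => ?_
    ring
  · refine (hlimit ((c - N) ^ 2)).congr fun β₀ => ?_
    ring

theorem tendsto_leadSlope (G c : ℝ) (s : SignType) :
    Tendsto (fun N => leadSlope G c N s / N) atTop (𝓝 (-gaugeSign s)) := by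
  have hlimit (A : ℝ) := tendsto_affine_div A (-gaugeSign s)
  cases s <;> simp only [leadSlope, gaugeSign] at hlimit ⊢
  · exact (hlimit (-(G + 1) / 2)).congr fun N => by ring
  · exact (hlimit (c + G)).congr fun N => by ring
  · exact (hlimit (-c)).congr fun N => by ring

theorem tendsto_coeffRacah (hj : 1 ≤ j) (hjp : j ≤ p) (hγ : γ ∈ genericParams p j n) (N : ℝ)
    (ν : Fin j → SignType) :
    Tendsto (fun β₀ : ℝ => coeffRacah p j γ β₀ N n ν / β₀) atTop
      (𝓝 (leadSlope (revParam γ 0) (revSum n 0) N (entry ν 1) *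
        (gaugeSign (entry ν 1) * pathWeight γ n ν))) := by
  refine ((tendsto_racahB_first _ _ _ _).mul_const _).congr fun β₀ => ?_
  rw [coeffRacah_eq hjp hγ, dualBeta_succ γ β₀ N p.zero_le, dualX_succ γ β₀ N n (by lia),
    SignType.zero_eq_zero]
  ring

theorem coeffHahn_eq (hj : 1 ≤ j) (hjp : j ≤ p) (hγ : γ ∈ genericParams p j n) (N : ℝ)
    (ν : Fin j → SignType) :
    coeffHahn p j γ N n ν = leadSlope (revParam γ 0) (revSum n 0) N (entry ν 1) *
        (gaugeSign (entry ν 1) * pathWeight γ n ν) :=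
  (tendsto_coeffRacah hj hjp hγ N ν).limUnder_eq

theorem tendsto_coeffHahn (hj : 1 ≤ j) (hjp : j ≤ p) (hγ : γ ∈ genericParams p j n)
    (ν : Fin j → SignType) :
    Tendsto (fun N : ℝ => coeffHahn p j γ N n ν / N) atTop (𝓝 (-pathWeight γ n ν)) := by
  have h := (tendsto_leadSlope (revParam γ 0) (revSum n 0) (entry ν 1)).mul_const
    (gaugeSign (entry ν 1) * pathWeight γ n ν)
  rw [neg_mul, ← mul_assoc, gaugeSign_mul_self, one_mul] at h
  refine h.congr fun N => ?_
  rw [coeffHahn_eq hj hjp hγ, mul_div_right_comm]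

theorem coeffJacobi_eq (hj : 1 ≤ j) (hjp : j ≤ p) (hγ : γ ∈ genericParams p j n)
    (ν : Fin j → SignType) : coeffJacobi p j γ n ν = -pathWeight γ n ν :=
  (tendsto_coeffHahn hj hjp hγ ν).limUnder_eq

end Limits

section Generic

variable {p j : ℕ} {γ : Fin (p + 1) → ℝ} {n : Fin p → ℕ}

theorem neg_one_lt_levelParam (hγ : ∀ i, -1 < γ i) {i : ℕ} (hi : i ≤ p) :
    -1 < levelParam γ i := by
  induction i with
  | zero =>
    rw [levelParam, psum_succ γ p.succ_pos, psum_zero]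
    simpa using hγ _
  | succ i ih =>
    linarith [levelParam_succ_sub γ hi, hγ (Fin.succ ⟨i, hi⟩), ih (Nat.le_of_succ_le hi)]

theorem regularParams_of (hjp : j ≤ p) (h : γ ∈ genericParams p j n ∨ ∀ i, -1 < γ i) :
    RegularParams γ n j := by
  intro k hk
  obtain h | h := h
  · have hne := two_mul_revSum_add_ne_zero hjp h hk
    split_ifs with hzero
    · simpa [hzero] using hne 1
    · exact hne
  · have hparam : -1 < revParam γ k := neg_one_lt_levelParam h (Nat.sub_le p k)
    split_ifs with hzero
    · linarith
    · intro ε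
      have hsum : (1 : ℝ) ≤ revSum n k := by
        exact_mod_cast (revSum_nonneg k).lt_of_ne' hzero
      have hε : (-1 : ℝ) ≤ ε := by cases ε <;> simp
      linarith

theorem continuous_psum (k : ℕ) : Continuous fun γ : Fin (p + 1) → ℝ => psum γ k := by
  refine continuous_finsetSum _ fun i _ => ?_
  split_ifs
  · exact continuous_apply i
  · exact continuous_const

theorem continuous_revParam (k : ℕ) : Continuous fun γ : Fin (p + 1) → ℝ => revParam γ k :=
  (continuous_psum _).add continuous_const

theorem revSum_add_entry_nonneg (hjp : j ≤ p) {ν : Fin j → SignType} (hν : 0 ≤ dualShift ν n)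
    {k : ℕ} (hk : k ≤ p) : 0 ≤ revSum n k + entry ν (k + 1) := by
  have hpsum : 0 ≤ psum (dualShift ν n) (p - k) := Finset.sum_nonneg fun i _ => by
    split_ifs
    · exact hν i
    · exact le_rfl
  rwa [psum_dualShift hjp ν (Nat.sub_le p k), show p + 1 - (p - k) = k + 1 by lia] at hpsum

theorem continuousAt_pathWeight (hjp : j ≤ p) (hreg : RegularParams γ n j) (ν : Fin j → SignType) :
    ContinuousAt (fun γ' => pathWeight γ' n ν) γ := by
  by_cases hν : 0 ≤ dualShift ν n
  · refine tendsto_finsetProd _ fun k hk => ?_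
    have hkj := Finset.mem_range.mp hk
    refine continuousAt_regConnCoeff ?_ ?_ _
      (hreg.regularStep hkj (revSum_add_entry_nonneg hjp hν (Nat.succ_le_of_lt (hkj.trans_le hjp))))
    · exact ((continuous_revParam _).sub (continuous_revParam _)).continuousAt
    · exact (continuous_const.add (continuous_revParam _)).continuousAt
  · simp only [pathWeight_eq_zero_of_not_nonneg hν]
    exact continuousAt_const

theorem psum_add_single (γ : Fin (p + 1) → ℝ) (t : ℝ) (m : ℕ) :
    psum (γ + Pi.single 0 t : Fin (p + 1) → ℝ) (m + 1) = psum γ (m + 1) + t := by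
  have hsplit (i : Fin (p + 1)) :
      (if (i : ℕ) < m + 1 then (γ + Pi.single 0 t : Fin (p + 1) → ℝ) i else 0) =
      (if (i : ℕ) < m + 1 then γ i else 0) + if i = 0 then t else 0 := by
    obtain rfl | hi := eq_or_ne i 0
    · simp
    · simp [hi]
  simp only [psum, hsplit, Finset.sum_add_distrib, Finset.sum_ite_eq', Finset.mem_univ, if_true]

theorem eventually_add_single_mem_genericParams (j : ℕ) (γ : Fin (p + 1) → ℝ) (n : Fin p → ℕ) :
    ∀ᶠ t in 𝓝[≠] 0, γ + Pi.single 0 t ∈ genericParams p j n := by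
  have hall : ∀ᶠ t : ℝ in 𝓝[≠] 0, ∀ m ∈ Finset.range (p + 1), ∀ ε : SignType,
      t ≠ -(2 * ((psum n m : ℕ) : ℝ) + psum γ (m + 1) + m + ε) := by
    rw [Filter.eventually_all_finset]
    exact fun m _ => Filter.eventually_all.mpr fun ε =>
      nhdsNE_le_cofinite 0 (eventually_cofinite_ne _)
  filter_upwards [hall] with t ht m _ hm ε hzero
  refine ht m (Finset.mem_range.mpr (Nat.lt_succ_of_le hm)) ε ?_
  rw [psum_add_single] at hzero
  linarith

theorem mem_closure_genericParams (j : ℕ) (γ : Fin (p + 1) → ℝ) (n : Fin p → ℕ) :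
    γ ∈ closure (genericParams p j n) := by
  have hcont : Continuous fun t : ℝ => γ + Pi.single 0 t :=
    continuous_const.add (continuous_single (A := fun _ : Fin (p + 1) => ℝ) 0)
  refine mem_closure_of_tendsto (b := 𝓝[≠] (0 : ℝ)) ?_
    (eventually_add_single_mem_genericParams j γ n)
  simpa using (hcont.tendsto 0).mono_left nhdsWithin_le_nhds

theorem tendsto_coeffJacobi (hj : 1 ≤ j) (hjp : j ≤ p) (hreg : RegularParams γ n j)
    (ν : Fin j → SignType) :
    Tendsto (fun γ' => coeffJacobi p j γ' n ν) (𝓝[genericParams p j n] γ)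
      (𝓝 (-pathWeight γ n ν)) := by
  refine ((continuousAt_pathWeight hjp hreg ν).neg.mono_left nhdsWithin_le_nhds).congr' ?_
  filter_upwards [self_mem_nhdsWithin] with γ' hγ'
  exact (coeffJacobi_eq hj hjp hγ' ν).symm

theorem coeffN_eq (hj : 1 ≤ j) (hjp : j ≤ p) (hreg : RegularParams γ n j)
    (ν : Fin j → SignType) : coeffN p j γ n ν = -pathWeight γ n ν := by
  have : (𝓝[genericParams p j n] γ).NeBot :=
    mem_closure_iff_nhdsWithin_neBot.mp (mem_closure_genericParams j γ n)
  exact (tendsto_coeffJacobi hj hjp hreg ν).limUnder_eq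

theorem opN_jacobiSimplex (hγ : ∀ k : Fin p, ∀ i : ℕ, γ k.succ + 1 + i ≠ 0) (hj : 1 ≤ j)
    (hjp : j ≤ p) (hreg : RegularParams γ n j) (F : (Fin p → ℤ) → MvPolynomial (Fin p) ℝ)
    (hF : ∀ m : Fin p → ℕ, F (fun i => (m i : ℤ)) = jacobiSimplex p γ m) :
    opN p j γ F n = kappaHat p j * jacobiSimplex p γ n := by
  have hterm (ν : Fin j → SignType) : (if ν = 0 then 0 else
      MvPolynomial.C (coeffN p j γ n ν) * (F (dualShift ν n) - F fun i => (n i : ℤ))) =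
      MvPolynomial.C (pathWeight γ n ν) * jacobiSimplex p γ n -
        MvPolynomial.C (pathWeight γ n ν) * jacobiInt γ (dualShift ν n) := by
    rw [← pathWeight_mul_eq F hF, coeffN_eq hj hjp hreg, hF]
    split_ifs with hzero
    · rw [hzero, dualShift_zero, hF, sub_self]
    · rw [map_neg]
      ring
  simp only [opN, hterm, Finset.sum_sub_distrib, ← Finset.sum_mul, ← map_sum,
    sum_pathWeight hγ (hj.trans hjp) hjp hreg, sum_pathWeight_mul_jacobiInt hγ hjp hreg, map_one]
  rw [kappaHat, Zsum, if_pos (by lia), sub_mul]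

end Generic

section Derivations

open MvPolynomial (X C pderiv)

theorem derivation_comm {σ : Type*} {D D' : Derivation ℝ (MvPolynomial σ ℝ) (MvPolynomial σ ℝ)}
    (h : ∀ i, D (D' (X i)) = D' (D (X i))) (f : MvPolynomial σ ℝ) : D (D' f) = D' (D f) := by
  have hcomm : ⁅D, D'⁆ = 0 := MvPolynomial.derivation_ext fun i => by
    rw [Derivation.commutator_apply, h, sub_self, Derivation.zero_apply]
  rw [← sub_eq_zero, ← Derivation.commutator_apply, hcomm, Derivation.zero_apply]

theorem pderiv_comm {σ : Type*} (l m : σ) (f : MvPolynomial σ ℝ) :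
    pderiv l (pderiv m f) = pderiv m (pderiv l f) := by
  classical
  refine derivation_comm (fun i => ?_) f
  simp only [MvPolynomial.pderiv_X, Pi.single_apply]
  split_ifs <;> simp

theorem derivation_eq_sum_pderiv {σ : Type*} [Fintype σ]
    (D : Derivation ℝ (MvPolynomial σ ℝ) (MvPolynomial σ ℝ)) (f : MvPolynomial σ ℝ) :
    D f = ∑ m, D (X m) * pderiv m f := by
  classical
  have hsum (g : MvPolynomial σ ℝ) :
      (∑ m, D (X m) • pderiv m : Derivation ℝ (MvPolynomial σ ℝ) (MvPolynomial σ ℝ)) g =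
        ∑ m, D (X m) * pderiv m g :=
    (congrFun (map_sum Derivation.coeFnAddMonoidHom (fun m => D (X m) • pderiv (R := ℝ) m)
      Finset.univ) g).trans (Finset.sum_apply _ _ _)
  rw [← hsum]
  congr 1
  refine MvPolynomial.derivation_ext fun i => ?_
  simp [hsum, MvPolynomial.pderiv_X, Pi.single_apply]

theorem derivation_psum {σ : Type*} (D : Derivation ℝ (MvPolynomial σ ℝ) (MvPolynomial σ ℝ))
    {m : ℕ} (v : Fin m → MvPolynomial σ ℝ) (k : ℕ) :
    D (psum v k) = psum (fun i => D (v i)) k := by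
  simp only [psum, map_sum, apply_ite D, map_zero]

end Derivations

section Euler

open MvPolynomial (X C pderiv)

variable {p : ℕ}

/-- The derivation `∑_{m ≤ j+1} z_m ∂_{z_m}`. -/
noncomputable def euler (p j : ℕ) :
    Derivation ℝ (MvPolynomial (Fin p) ℝ) (MvPolynomial (Fin p) ℝ) :=
  MvPolynomial.mkDerivation ℝ fun m : Fin p => if (m : ℕ) < j + 1 then X m else 0

/-- The derivation `∂_{z_{j+2}}`, or `0` if there is no such variable. -/
noncomputable def nextPDeriv (p j : ℕ) :
    Derivation ℝ (MvPolynomial (Fin p) ℝ) (MvPolynomial (Fin p) ℝ) :=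
  if h : j + 1 < p then pderiv ⟨j + 1, h⟩ else 0

/-- The Euler operator `∑_{k ≤ j+1} Z_1^k ∂_{Z_1^k}` of the coordinates `Z_1^1, …, Z_1^p`, for
`j < p`. In the coordinates `z` it is `∑_{m ≤ j+1} z_m ∂_{z_m} - Z_1^{j+1} ∂_{z_{j+2}}`. -/
noncomputable def levelEuler (p j : ℕ) :
    Derivation ℝ (MvPolynomial (Fin p) ℝ) (MvPolynomial (Fin p) ℝ) :=
  euler p j - Zsum p (j + 1) • nextPDeriv p j

theorem euler_X (j : ℕ) (m : Fin p) : euler p j (X m) = if (m : ℕ) < j + 1 then X m else 0 :=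
  MvPolynomial.mkDerivation_X ..

theorem nextPDeriv_X (j : ℕ) (m : Fin p) :
    nextPDeriv p j (X m) = if (m : ℕ) = j + 1 then 1 else 0 := by
  have := m.2
  unfold nextPDeriv
  split_ifs with h hm hm
  · rw [← Fin.ext (a := m) (b := ⟨j + 1, h⟩) hm, MvPolynomial.pderiv_X_self]
  · exact MvPolynomial.pderiv_X_of_ne fun h' => hm (congrArg Fin.val h')
  · lia
  · rfl

theorem levelEuler_apply (j : ℕ) (f : MvPolynomial (Fin p) ℝ) :
    levelEuler p j f = euler p j f - Zsum p (j + 1) * nextPDeriv p j f := rfl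

theorem euler_apply (j : ℕ) (f : MvPolynomial (Fin p) ℝ) :
    euler p j f = psum (fun m => X m * pderiv m f) (j + 1) := by
  simp only [derivation_eq_sum_pderiv (euler p j) f, euler_X, psum, ite_mul, zero_mul]

theorem euler_Zsum_self {j : ℕ} (hj : j < p) : euler p j (Zsum p (j + 1)) = Zsum p (j + 1) := by
  rw [Zsum, if_pos (Nat.succ_le_of_lt hj), derivation_psum]
  exact Finset.sum_congr rfl fun m _ => by split_ifs with h <;> simp [euler_X, h]

theorem nextPDeriv_Zsum_self {j : ℕ} (hj : j < p) : nextPDeriv p j (Zsum p (j + 1)) = 0 := by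
  rw [Zsum, if_pos (Nat.succ_le_of_lt hj), derivation_psum]
  exact Finset.sum_eq_zero fun m _ => by simp only [nextPDeriv_X]; split_ifs <;> lia

theorem nextPDeriv_euler (j : ℕ) (f : MvPolynomial (Fin p) ℝ) :
    nextPDeriv p j (euler p j f) = euler p j (nextPDeriv p j f) := by
  refine derivation_comm (fun m => ?_) f
  rw [euler_X, nextPDeriv_X, apply_ite (nextPDeriv p j), apply_ite (euler p j), nextPDeriv_X]
  split_ifs <;> first | lia | simp

theorem levelEuler_psum_X {j : ℕ} (hj : j < p) {k : ℕ} (hk : k ≤ p) :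
    levelEuler p j (psum X k) = if k ≤ j + 1 then psum X k else 0 := by
  induction k with
  | zero => simp [psum_zero]
  | succ k ih =>
    rw [psum_succ _ hk, map_add, ih (Nat.le_of_succ_le hk), levelEuler_apply, euler_X, nextPDeriv_X,
      Zsum, if_pos (Nat.succ_le_of_lt hj)]
    obtain h | rfl | h := lt_trichotomy k (j + 1)
    · simp [h, h.le, h.ne, Nat.succ_le_of_lt h]
    · simp
    · simp [h.not_ge, h.not_gt, h.ne', (h.trans k.lt_succ_self).not_ge]

theorem levelEuler_Zsum {j : ℕ} (hj : j < p) (k : ℕ) :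
    levelEuler p j (Zsum p (k + 1)) = if k ≤ j then Zsum p (k + 1) else 0 := by
  unfold Zsum
  by_cases hk : k + 1 ≤ p
  · simp only [if_pos hk, levelEuler_psum_X hj hk, Nat.add_le_add_iff_right]
  · rw [if_neg hk, if_neg (by lia), Derivation.map_one_eq_zero]

theorem Zsum_succ_sub {j : ℕ} (hj : j + 1 < p) :
    Zsum p (j + 2) - Zsum p (j + 1) = X ⟨j + 1, hj⟩ := by
  rw [Zsum, Zsum, if_pos (Nat.succ_le_of_lt hj), if_pos hj.le, psum_succ _ hj, add_sub_cancel_left]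

theorem nextPDeriv_of_le {j : ℕ} (hj : p ≤ j + 1) : nextPDeriv p j = 0 := dif_neg hj.not_gt

theorem nextPDeriv_of_lt {j : ℕ} (hj : j + 1 < p) : nextPDeriv p j = pderiv ⟨j + 1, hj⟩ :=
  dif_pos hj

theorem euler_succ (j : ℕ) (f : MvPolynomial (Fin p) ℝ) :
    euler p (j + 1) f =
      euler p j f + (Zsum p (j + 2) - Zsum p (j + 1)) * nextPDeriv p j f := by
  rw [euler_apply, euler_apply]
  by_cases hj : j + 1 < p
  · rw [psum_succ _ hj, Zsum_succ_sub hj, nextPDeriv_of_lt hj]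
  · rw [psum_add_one_of_le _ (not_lt.mp hj), nextPDeriv_of_le (not_lt.mp hj),
      Derivation.zero_apply, mul_zero, add_zero]

/-- The part `∑_{m ≤ j+1} (z_m ∂_{z_m}² + (γ_m + 1) ∂_{z_m})` of `opZ` multiplied by `Z_1^{j+1}`. -/
noncomputable def diagOp (p j : ℕ) (γ : Fin (p + 1) → ℝ) (f : MvPolynomial (Fin p) ℝ) :
    MvPolynomial (Fin p) ℝ :=
  psum (fun m => X m * pderiv m (pderiv m f) + C (γ m.castSucc + 1) * pderiv m f) (j + 1)

theorem diagOp_succ {j : ℕ} (hj : j < p) (γ : Fin (p + 1) → ℝ) (f : MvPolynomial (Fin p) ℝ) :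
    diagOp p (j + 1) γ f = diagOp p j γ f +
      (Zsum p (j + 2) - Zsum p (j + 1)) * nextPDeriv p j (nextPDeriv p j f) +
      C (levelParam γ (j + 1) - levelParam γ j) * nextPDeriv p j f := by
  unfold diagOp
  by_cases hj' : j + 1 < p
  · rw [psum_succ _ hj', Zsum_succ_sub hj', nextPDeriv_of_lt hj', levelParam_succ_sub γ hj,
      Fin.castSucc_mk, Fin.succ_mk, add_assoc]
  · rw [psum_add_one_of_le _ (not_lt.mp hj'), nextPDeriv_of_le (not_lt.mp hj')]
    simp only [Derivation.zero_apply, mul_zero, add_zero]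

theorem nextPDeriv_sub_mul_nextPDeriv (j : ℕ) (f : MvPolynomial (Fin p) ℝ) :
    nextPDeriv p j ((Zsum p (j + 2) - Zsum p (j + 1)) * nextPDeriv p j f) =
      nextPDeriv p j f +
        (Zsum p (j + 2) - Zsum p (j + 1)) * nextPDeriv p j (nextPDeriv p j f) := by
  by_cases hj : j + 1 < p
  · rw [Zsum_succ_sub hj, Derivation.leibniz, nextPDeriv_X, if_pos rfl, smul_eq_mul, smul_eq_mul,
      mul_one, add_comm]
  · simp [nextPDeriv_of_le (not_lt.mp hj)]

theorem euler_sub_mul_nextPDeriv (j : ℕ) (f : MvPolynomial (Fin p) ℝ) :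
    euler p j ((Zsum p (j + 2) - Zsum p (j + 1)) * nextPDeriv p j f) =
      (Zsum p (j + 2) - Zsum p (j + 1)) * euler p j (nextPDeriv p j f) := by
  by_cases hj : j + 1 < p
  · rw [Zsum_succ_sub hj, Derivation.leibniz, euler_X, if_neg (lt_irrefl _), smul_zero, add_zero,
      smul_eq_mul]
  · simp [nextPDeriv_of_le (not_lt.mp hj)]

end Euler

section DifferentialOperator

open MvPolynomial (X C pderiv)

variable {p : ℕ}

theorem sum_sum_eq_of_symm {R : Type*} [CommRing R] {ι : Type*} [Fintype ι] [LinearOrder ι]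
    (T : ι → ι → R) (hT : ∀ l m, T l m = T m l) :
    ∑ l, ∑ m, T l m = 2 * (∑ l, ∑ m, if l < m then T l m else 0) + ∑ m, T m m := by
  have htri (l m : ι) : T l m = (if l < m then T l m else 0) + (if m < l then T m l else 0) +
      if l = m then T l m else 0 := by
    obtain h | rfl | h := lt_trichotomy l m
    · simp [h, h.ne, h.not_gt]
    · simp
    · simp [h, h.ne', h.not_gt, hT l m]
  have hflip : ∑ l, ∑ m, (if m < l then T m l else 0) = ∑ l, ∑ m, if l < m then T l m else 0 :=
    Finset.sum_comm
  calc ∑ l, ∑ m, T l m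
      = ∑ l, ∑ m, ((if l < m then T l m else 0) + (if m < l then T m l else 0) +
          if l = m then T l m else 0) :=
        Finset.sum_congr rfl fun l _ => Finset.sum_congr rfl fun m _ => htri l m
    _ = _ := by
        simp only [Finset.sum_add_distrib, hflip, Finset.sum_ite_eq, Finset.mem_univ, if_true]
        ring

theorem euler_euler (j : ℕ) (f : MvPolynomial (Fin p) ℝ) :
    euler p j (euler p j f) = euler p j f +
      ∑ l, ∑ m, euler p j (X l) * euler p j (X m) * pderiv l (pderiv m f) := by
  have hXX (m : Fin p) : euler p j (euler p j (X m)) = euler p j (X m) := by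
    simp only [euler_X]
    split_ifs with h <;> simp [euler_X, h]
  conv_lhs => rw [derivation_eq_sum_pderiv (euler p j) f]
  simp only [map_sum, Derivation.leibniz, hXX, smul_eq_mul, Finset.sum_add_distrib]
  rw [add_comm, Finset.sum_comm, derivation_eq_sum_pderiv (euler p j) f]
  congr 1
  · exact Finset.sum_congr rfl fun m _ => mul_comm _ _
  · refine Finset.sum_congr rfl fun m _ => ?_
    rw [derivation_eq_sum_pderiv (euler p j) (pderiv m f), Finset.mul_sum]
    exact Finset.sum_congr rfl fun l _ => by ring

theorem opZ_eq (j : ℕ) (γ : Fin (p + 1) → ℝ) (f : MvPolynomial (Fin p) ℝ) :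
    opZ p j γ f = Zsum p (j + 1) * diagOp p j γ f - euler p j (euler p j f) -
      C (levelParam γ j) * euler p j f := by
  have hsymm := sum_sum_eq_of_symm (fun l m : Fin p => euler p j (X l) * euler p j (X m) *
    pderiv l (pderiv m f)) fun l m => by rw [pderiv_comm l m, mul_comm (euler p j (X l))]
  have hoff (l m : Fin p) : (if l < m ∧ (m : ℕ) < j + 1 then
      X l * X m * pderiv l (pderiv m f) else 0) =
      if l < m then euler p j (X l) * euler p j (X m) * pderiv l (pderiv m f) else 0 := by
    rw [ite_and]
    split_ifs with hlm hm
    · rw [euler_X, euler_X, if_pos hm, if_pos (hm.trans' hlm)]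
    · rw [euler_X _ m, if_neg hm, mul_zero, zero_mul]
    · rfl
  have hdiag (m : Fin p) :
      (if (m : ℕ) < j + 1 then X m * (Zsum p (j + 1) - X m) * pderiv m (pderiv m f) else 0) +
      (if (m : ℕ) < j + 1 then (C (γ m.castSucc + 1) * Zsum p (j + 1)
        - C (psum γ (j + 1) + j + 1) * X m) * pderiv m f else 0) =
      Zsum p (j + 1) * (if (m : ℕ) < j + 1 then
        X m * pderiv m (pderiv m f) + C (γ m.castSucc + 1) * pderiv m f else 0) -
      euler p j (X m) * euler p j (X m) * pderiv m (pderiv m f) -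
      C (levelParam γ j + 1) * (euler p j (X m) * pderiv m f) := by
    rw [euler_X, levelParam]
    split_ifs <;> ring
  rw [euler_euler, hsymm, opZ, add_assoc, ← Finset.sum_add_distrib,
    Finset.sum_congr rfl fun m _ => hdiag m]
  simp only [hoff, diagOp, psum, Finset.sum_sub_distrib, ← Finset.mul_sum,
    ← derivation_eq_sum_pderiv, map_add, map_one]
  ring

theorem opZ_zero (γ : Fin (p + 1) → ℝ) (f : MvPolynomial (Fin p) ℝ) : opZ p 0 γ f = 0 := by
  have hfirst (m : Fin p) (hm : (m : ℕ) < 0 + 1) :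
      Zsum p (0 + 1) = X m ∧ psum γ (0 + 1) = γ m.castSucc := by
    obtain ⟨m, hp⟩ := m
    obtain rfl : m = 0 := Nat.lt_one_iff.mp hm
    rw [Zsum, if_pos (Nat.succ_le_of_lt hp), psum_succ _ hp, psum_succ _ p.succ_pos, psum_zero,
      psum_zero, zero_add, zero_add]
    exact ⟨rfl, rfl⟩
  have hoff (l m : Fin p) : ¬(l < m ∧ (m : ℕ) < 0 + 1) := fun h => by lia
  simp only [opZ, hoff, if_false, Finset.sum_const_zero, mul_zero, zero_add]
  rw [← Finset.sum_add_distrib]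
  refine Finset.sum_eq_zero fun m _ => ?_
  split_ifs with hm
  · simp [(hfirst m hm).1, (hfirst m hm).2]
  · exact add_zero _

theorem mul_opZ_succ {j : ℕ} (hj : j < p) (γ : Fin (p + 1) → ℝ) (f : MvPolynomial (Fin p) ℝ) :
    Zsum p (j + 1) * opZ p (j + 1) γ f =
      Zsum p (j + 2) * opZ p j γ f +
      (Zsum p (j + 2) - Zsum p (j + 1)) * levelEuler p j (levelEuler p j f) +
      (C (levelParam γ j) * Zsum p (j + 2) - C (levelParam γ (j + 1)) * Zsum p (j + 1)) *
        levelEuler p j f := by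
  simp only [opZ_eq, euler_succ, diagOp_succ hj, levelEuler_apply, map_add, map_sub,
    nextPDeriv_sub_mul_nextPDeriv, euler_sub_mul_nextPDeriv, nextPDeriv_euler]
  simp only [Derivation.leibniz, euler_Zsum_self hj, nextPDeriv_Zsum_self hj, smul_eq_mul]
  ring

end DifferentialOperator

section Eigenfunctions

open MvPolynomial (C)

variable {p : ℕ} {E : Derivation ℝ (MvPolynomial (Fin p) ℝ) (MvPolynomial (Fin p) ℝ)}
  {f g u v : MvPolynomial (Fin p) ℝ} {x y : ℝ}

theorem derivation_mul_of_eigen (hf : E f = x • f) (hg : E g = y • g) :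
    E (f * g) = (x + y) • (f * g) := by
  rw [Derivation.leibniz, hf, hg, smul_eq_mul, smul_eq_mul, mul_smul_comm, mul_smul_comm,
    mul_comm g f, ← add_smul, add_comm]

theorem derivation_prod_of_eigen {ι : Type*} {s : Finset ι} {f : ι → MvPolynomial (Fin p) ℝ}
    {x : ι → ℝ} (h : ∀ i ∈ s, E (f i) = x i • f i) :
    E (∏ i ∈ s, f i) = (∑ i ∈ s, x i) • ∏ i ∈ s, f i := by
  induction s using Finset.cons_induction with
  | empty => rw [Finset.prod_empty, Derivation.map_one_eq_zero, Finset.sum_empty, zero_smul]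
  | cons a s ha ih =>
    rw [Finset.prod_cons, Finset.sum_cons, derivation_mul_of_eigen (h a (Finset.mem_cons_self a s))
      (ih fun i hi => h i (Finset.mem_cons_of_mem hi))]

theorem derivation_pow_of_eigen (hf : E f = x • f) (k : ℕ) : E (f ^ k) = (k * x) • f ^ k := by
  simpa using derivation_prod_of_eigen (s := Finset.range k) fun _ _ => hf

theorem derivation_sum_monomial (hu : E u = x • u) (hv : E v = y • v) (c : ℕ → ℝ) (n : ℕ) :
    E (∑ i ∈ Finset.range (n + 1), C (c i) * (u ^ i * v ^ (n - i))) =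
      ∑ i ∈ Finset.range (n + 1), C ((i * x + (n - i) * y) * c i) * (u ^ i * v ^ (n - i)) := by
  rw [map_sum]
  refine Finset.sum_congr rfl fun i hi => ?_
  rw [← MvPolynomial.smul_eq_C_mul, Derivation.map_smul,
    derivation_mul_of_eigen (derivation_pow_of_eigen hu i) (derivation_pow_of_eigen hv (n - i)),
    Nat.cast_sub (Finset.mem_range_succ_iff.mp hi), smul_smul,
    MvPolynomial.smul_eq_C_mul, mul_comm (c i)]

theorem derivation_quadratic_sum_monomial (hu : E u = u) (hv : E v = 0) (c : ℕ → ℝ) (n : ℕ)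
    (s t : ℝ) :
    E (E (∑ i ∈ Finset.range (n + 1), C (c i) * (u ^ i * v ^ (n - i)))) +
        s • E (∑ i ∈ Finset.range (n + 1), C (c i) * (u ^ i * v ^ (n - i))) +
        t • ∑ i ∈ Finset.range (n + 1), C (c i) * (u ^ i * v ^ (n - i)) =
      ∑ i ∈ Finset.range (n + 1), C ((i ^ 2 + s * i + t) * c i) * (u ^ i * v ^ (n - i)) := by
  have hE (c : ℕ → ℝ) : E (∑ i ∈ Finset.range (n + 1), C (c i) * (u ^ i * v ^ (n - i))) =
      ∑ i ∈ Finset.range (n + 1), C (i * c i) * (u ^ i * v ^ (n - i)) := by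
    simpa only [mul_one, mul_zero, add_zero] using
      derivation_sum_monomial (x := 1) (y := 0) (by rwa [one_smul]) (by rwa [zero_smul]) c n
  rw [hE, hE fun i => i * c i, Finset.smul_sum, Finset.smul_sum, ← Finset.sum_add_distrib,
    ← Finset.sum_add_distrib]
  refine Finset.sum_congr rfl fun i _ => ?_
  simp only [MvPolynomial.smul_eq_C_mul, map_mul, map_add, map_pow]
  ring

theorem derivation_jacobiNorm_of_eigen (hu : E u = x • u) (hv : E v = x • v) (d b : ℝ) (m : ℤ) :
    E (jacobiNorm u v d b m) = (m * x) • jacobiNorm u v d b m := by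
  rcases m with n | n
  · rw [Int.ofNat_eq_natCast, jacobiNorm_natCast, derivation_sum_monomial hu hv, Finset.smul_sum]
    refine Finset.sum_congr rfl fun i _ => ?_
    rw [← add_mul, add_sub_cancel, map_mul, mul_assoc, MvPolynomial.smul_eq_C_mul, Int.cast_natCast]
  · rw [jacobiNorm_of_neg _ _ _ _ (Int.negSucc_lt_zero n), map_zero, smul_zero]

theorem jacobiNormCoeff_succ (d b : ℝ) {n i : ℕ} (hi : i < n) :
    (i + 1) * (i + 1 + (b - n - d)) * jacobiNormCoeff d b n (i + 1) =
      (i - n) * (i + b) * jacobiNormCoeff d b n i := by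
  obtain ⟨r, rfl⟩ := Nat.exists_eq_add_of_lt hi
  rw [jacobiNormCoeff_eq, jacobiNormCoeff_eq, show i + r + 1 - i = r + 1 by lia,
    show i + r + 1 - (i + 1) = r by lia, poch_succ _ i, poch_succ _ i, poch_succ_left _ r,
    Nat.factorial_succ]
  have hfact : (i.factorial : ℝ) ≠ 0 := Nat.cast_ne_zero.mpr i.factorial_ne_zero
  have hsucc : (i : ℝ) + 1 ≠ 0 := Nat.cast_add_one_ne_zero i
  push_cast
  rw [← add_assoc (b - _ - d + 1) (i : ℝ) 1]
  by_cases hd : poch d (i + r + 1) = 0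
  · simp [hd]
  · field_simp
    ring

theorem jacobiNorm_differential_eq (hu : E u = u) (hv : E v = 0) (d b : ℝ) (m : ℤ) :
    v * (E (E (jacobiNorm u v d b m)) + (b - m - d) • E (jacobiNorm u v d b m)) =
      u * (E (E (jacobiNorm u v d b m)) + (b - m) • E (jacobiNorm u v d b m) -
        (m * b) • jacobiNorm u v d b m) := by
  rcases m with n | n
  swap
  · rw [jacobiNorm_of_neg _ _ _ _ (Int.negSucc_lt_zero n)]
    simp only [map_zero, smul_zero, add_zero, sub_zero, mul_zero]
  have hleft := derivation_quadratic_sum_monomial hu hv (jacobiNormCoeff d b n) n (b - n - d) 0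
  have hright :=
    derivation_quadratic_sum_monomial hu hv (jacobiNormCoeff d b n) n (b - n) (-(n * b))
  rw [← jacobiNorm_natCast] at hleft hright
  rw [zero_smul, add_zero] at hleft
  rw [neg_smul, ← sub_eq_add_neg] at hright
  rw [Int.ofNat_eq_natCast, Int.cast_natCast, hleft, hright, Finset.sum_range_succ',
    Finset.sum_range_succ, show (n : ℝ) ^ 2 + (b - n) * n + -(n * b) = 0 by ring,
    show ((0 : ℕ) : ℝ) ^ 2 + (b - n - d) * (0 : ℕ) + 0 = 0 by norm_num]
  simp only [zero_mul, map_zero, add_zero, Finset.mul_sum]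
  refine Finset.sum_congr rfl fun i hi => ?_
  have hin := Finset.mem_range.mp hi
  have hcoeff : (((i + 1 : ℕ) : ℝ) ^ 2 + (b - n - d) * (i + 1 : ℕ)) *
      jacobiNormCoeff d b n (i + 1) =
      (i ^ 2 + (b - n) * i + -(n * b)) * jacobiNormCoeff d b n i := by
    push_cast
    linear_combination jacobiNormCoeff_succ d b hin
  rw [hcoeff, show n - i = n - (i + 1) + 1 by lia]
  ring

end Eigenfunctions

section DifferentialEquation

open MvPolynomial (C)

variable {p : ℕ}

theorem levelEuler_prod_levelFactor (γ : Fin (p + 1) → ℝ) (a : ℕ → ℤ) {j : ℕ} (hj : j < p) :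
    levelEuler p j (∏ i ∈ Finset.range j, levelFactor γ i (a i) (a (i + 1))) =
      ((a j - a 0 : ℤ) : ℝ) • ∏ i ∈ Finset.range j, levelFactor γ i (a i) (a (i + 1)) := by
  rw [← Finset.sum_range_sub, Int.cast_sum]
  refine derivation_prod_of_eigen fun i hi => ?_
  have hij := Finset.mem_range.mp hi
  have hZ (k : ℕ) (hk : k ≤ j) :
      levelEuler p j (Zsum p (k + 1)) = (1 : ℝ) • Zsum p (k + 1) := by
    rw [levelEuler_Zsum hj, if_pos hk, one_smul]
  simpa only [levelFactor, mul_one] using derivation_jacobiNorm_of_eigen (hZ i hij.le)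
    (hZ (i + 1) hij) (levelParam γ (i + 1) - levelParam γ i)
    (a i + a (i + 1) + levelParam γ (i + 1)) (a (i + 1) - a i)

theorem levelEuler_levelFactor_of_lt (γ : Fin (p + 1) → ℝ) (a c : ℤ) {i j : ℕ} (hj : j < p)
    (hij : j < i) : levelEuler p j (levelFactor γ i a c) = 0 := by
  have hZ (k : ℕ) (hk : j < k) :
      levelEuler p j (Zsum p (k + 1)) = (0 : ℝ) • Zsum p (k + 1) := by
    rw [levelEuler_Zsum hj, if_neg hk.not_ge, zero_smul]
  simpa only [levelFactor, mul_zero, zero_smul] using derivation_jacobiNorm_of_eigen (hZ i hij)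
    (hZ (i + 1) (hij.trans i.lt_succ_self)) (levelParam γ (i + 1) - levelParam γ i)
    (a + c + levelParam γ (i + 1)) (c - a)

theorem levelFactor_differential_eq (γ : Fin (p + 1) → ℝ) (a c : ℤ) {j : ℕ} (hj : j < p) :
    Zsum p (j + 2) * (levelEuler p j (levelEuler p j (levelFactor γ j a c)) +
        C (2 * a + levelParam γ j) * levelEuler p j (levelFactor γ j a c)) =
      Zsum p (j + 1) * (levelEuler p j (levelEuler p j (levelFactor γ j a c)) +
        C (2 * a + levelParam γ (j + 1)) * levelEuler p j (levelFactor γ j a c) -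
        C ((c - a) * (a + c + levelParam γ (j + 1))) * levelFactor γ j a c) := by
  have hu : levelEuler p j (Zsum p (j + 1)) = Zsum p (j + 1) := by
    rw [levelEuler_Zsum hj, if_pos le_rfl]
  have hv : levelEuler p j (Zsum p (j + 2)) = 0 := by
    rw [levelEuler_Zsum hj (j + 1), if_neg j.lt_succ_self.not_ge]
  have hode := jacobiNorm_differential_eq hu hv (levelParam γ (j + 1) - levelParam γ j)
    (a + c + levelParam γ (j + 1)) (c - a)
  rw [← levelFactor] at hode
  have hleft : 2 * (a : ℝ) + levelParam γ (j + 1) - (levelParam γ (j + 1) - levelParam γ j) =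
      2 * a + levelParam γ j := by ring
  have hright : (a : ℝ) + c + levelParam γ (j + 1) - (c - a) = 2 * a + levelParam γ (j + 1) := by
    ring
  simpa only [MvPolynomial.smul_eq_C_mul, Int.cast_sub, hright, hleft] using hode

theorem opZ_prod_levelFactor_mul (γ : Fin (p + 1) → ℝ) (a : ℕ → ℤ) (ha : a 0 = 0) {j : ℕ}
    (hjp : j ≤ p) {ψ : MvPolynomial (Fin p) ℝ} (hψ : ∀ k < j, levelEuler p k ψ = 0) :
    opZ p j γ ((∏ i ∈ Finset.range j, levelFactor γ i (a i) (a (i + 1))) * ψ) =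
      C (-a j * (a j + levelParam γ j)) *
        ((∏ i ∈ Finset.range j, levelFactor γ i (a i) (a (i + 1))) * ψ) := by
  induction j generalizing ψ with
  | zero => simp [opZ_zero, ha]
  | succ j ih =>
    have hH := levelEuler_prod_levelFactor γ a hjp
    have hode := levelFactor_differential_eq γ (a j) (a (j + 1)) hjp
    have hker (k : ℕ) (hk : k < j) :
        levelEuler p k (levelFactor γ j (a j) (a (j + 1)) * ψ) = 0 := by
      rw [Derivation.leibniz, hψ k (hk.trans j.lt_succ_self),
        levelEuler_levelFactor_of_lt γ _ _ (hk.trans hjp) hk, smul_zero, smul_zero, add_zero]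
    apply mul_left_cancel₀ (Zsum_ne_zero (j.zero_le.trans_lt hjp) j)
    rw [mul_opZ_succ hjp, Finset.prod_range_succ, mul_assoc, ih (Nat.le_of_succ_le hjp) hker]
    simp only [Derivation.leibniz, hH, hψ j j.lt_succ_self, ha, smul_eq_mul, map_add, mul_zero,
      zero_add, MvPolynomial.smul_eq_C_mul, MvPolynomial.derivation_C, sub_zero]
    simp only [map_mul, map_add, map_sub, map_neg, map_ofNat] at hode ⊢
    linear_combination
      ((∏ i ∈ Finset.range j, levelFactor γ i (a i) (a (i + 1))) * ψ) * hode

theorem opZ_jacobiInt {j : ℕ} (hjp : j ≤ p) (γ : Fin (p + 1) → ℝ) (a : Fin p → ℤ) :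
    opZ p j γ (jacobiInt γ a) =
      C (-psum a j * (psum a j + levelParam γ j)) * jacobiInt γ a := by
  rw [jacobiInt, ← Finset.prod_range_mul_prod_Ico _ hjp]
  refine opZ_prod_levelFactor_mul γ (psum a) (psum_zero a) hjp fun k hk => ?_
  rw [derivation_prod_of_eigen (x := fun _ => 0), Finset.sum_const_zero, zero_smul]
  intro i hi
  rw [levelEuler_levelFactor_of_lt γ _ _ (hk.trans_le hjp) (hk.trans_le (Finset.mem_Ico.mp hi).1),
    zero_smul]

theorem opZ_jacobiSimplex {j : ℕ} (hjp : j ≤ p) (γ : Fin (p + 1) → ℝ) (n : Fin p → ℕ) :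
    opZ p j γ (jacobiSimplex p γ n) = C (muHat p j γ n) * jacobiSimplex p γ n := by
  rw [← jacobiInt_natCast, opZ_jacobiInt hjp, psum_natCast, muHat, levelParam, Int.cast_natCast,
    add_comm (psum γ _), ← add_assoc]

end DifferentialEquation

end SimplexJacobi

theorem theorem5p4_general {p j : ℕ} (hj1 : 1 ≤ j) (hjp : j ≤ p) {γ : Fin (p + 1) → ℝ}
    (hγ : ∀ k : Fin p, ∀ i : ℕ, γ k.succ + 1 + i ≠ 0) (n : Fin p → ℕ) :
    opZ p j γ (jacobiSimplex p γ n) = MvPolynomial.C (muHat p j γ n) * jacobiSimplex p γ n ∧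
    (∀ γ' ∈ genericParams p j n, ∀ ν : Fin j → SignType,
      (∀ N : ℝ, Tendsto (fun β₀ : ℝ => coeffRacah p j γ' β₀ N n ν / β₀) atTop
        (𝓝 (coeffHahn p j γ' N n ν))) ∧
      Tendsto (fun N : ℝ => coeffHahn p j γ' N n ν / N) atTop (𝓝 (coeffJacobi p j γ' n ν))) ∧
    (RegularParams γ n j →
      (∀ ν : Fin j → SignType,
        Tendsto (fun γ' => coeffJacobi p j γ' n ν) (𝓝[genericParams p j n] γ)
          (𝓝 (coeffN p j γ n ν))) ∧
      ∀ F : (Fin p → ℤ) → MvPolynomial (Fin p) ℝ,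
        (∀ m : Fin p → ℕ, F (fun i => (m i : ℤ)) = jacobiSimplex p γ m) →
        opN p j γ F n = kappaHat p j * jacobiSimplex p γ n) := by
  refine ⟨opZ_jacobiSimplex hjp γ n, fun γ' hγ' ν => ⟨fun N => ?_, ?_⟩,
    fun hreg => ⟨fun ν => ?_, ?_⟩⟩
  · rw [coeffHahn_eq hj1 hjp hγ']
    exact tendsto_coeffRacah hj1 hjp hγ' N ν
  · rw [coeffJacobi_eq hj1 hjp hγ']
    exact tendsto_coeffHahn hj1 hjp hγ' ν
  · rw [coeffN_eq hj1 hjp hreg]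
    exact tendsto_coeffJacobi hj1 hjp hreg ν
  · exact opN_jacobiSimplex hγ hj1 hjp hreg

theorem theorem5p4 (p j : ℕ) (hj1 : 1 ≤ j) (hjp : j ≤ p) (γ : Fin (p + 1) → ℝ)
    (hγ : ∀ k : Fin p, ∀ i : ℕ, γ k.succ + 1 + i ≠ 0) (n : Fin p → ℕ) :
    -- the differential equation in `z`
    opZ p j γ (jacobiSimplex p γ n) =
        MvPolynomial.C (muHat p j γ n) * jacobiSimplex p γ n ∧
    -- the limits that define the coefficients of the operator in `n` exist
    (∀ γ' ∈ genericParams p j n, ∀ ν : Fin j → SignType, ν ≠ 0 →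
      (∀ N : ℝ, Tendsto (fun β₀ : ℝ => coeffRacah p j γ' β₀ N n ν / β₀) atTop
        (𝓝 (coeffHahn p j γ' N n ν))) ∧
      Tendsto (fun N : ℝ => coeffHahn p j γ' N n ν / N) atTop (𝓝 (coeffJacobi p j γ' n ν))) ∧
    -- the coefficients are well defined and the difference equation in `n` holds,
    -- whatever values are given to the Jacobi polynomials at indices outside `ℕ^p`
    ((γ ∈ genericParams p j n ∨ ∀ i, -1 < γ i) →
      (∀ ν : Fin j → SignType, ν ≠ 0 →
        Tendsto (fun γ' => coeffJacobi p j γ' n ν) (𝓝[genericParams p j n] γ)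
          (𝓝 (coeffN p j γ n ν))) ∧
      ∀ F : (Fin p → ℤ) → MvPolynomial (Fin p) ℝ,
        (∀ m : Fin p → ℕ, F (fun i => (m i : ℤ)) = jacobiSimplex p γ m) →
        opN p j γ F n = kappaHat p j * jacobiSimplex p γ n) := by
  obtain ⟨hz, hlim, hn⟩ := theorem5p4_general hj1 hjp hγ n
  exact ⟨hz, fun γ' hγ' ν _ => hlim γ' hγ' ν,
    fun h => (hn (regularParams_of hjp h)).imp_left fun ht ν _ => ht ν⟩
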